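/- Let $n,k\ge 1$ be integers. (For $n\ge 2$ this concerns the affine Lie algebra $\widehat{\mathfrak{sl}}(n)$ at level $k$; the case $n=1$ is degenerate and is also covered by the formulas below.) Let $$P_k^+=\Bigl\{\hat\lambda=\sum_{i=0}^{n-1}m_i\hat\omega_i\ \Big|\ m_i\in\mathbb Z_{\ge0},\ \sum_{i=0}^{n-1} m_i=k\Bigr\}$$ be the set of integrable dominant weights of level $k$. To $\hat\lambda\in P_k^+$ associate: * its finite part $\sum_{i=1}^{n-1}m_i\omega_i$, where $\omega_i=\varepsilon_1+\dots+\varepsilon_i-\frac in\sum_{j=1}^n\varepsilon_j$, which is again denoted $\lambda$ when it stands inside the pairing $(\cdot,\cdot)$ with $(\varepsilon_i,\varepsilon_j)=\delta_{ij}$; * the partition $\lambda=(\lambda_1\ge\dots\ge\lambda_{n-1}\ge\lambda_n=0)$ with $\lambda_i-\lambda_{i+1}=m_i$ for $1\le i\le n-1$, and its transpose $\lambda^t$; * the conjugate weight $\hat\lambda^*=\sum_{i}m_{-i}\hat\omega_i$, with indices modulo $n$. Put $\rho=\sum_{j=1}^n\bigl(\frac{n+1}2-j\bigr)\varepsilon_j$,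 let $S_n$ act by permuting the $\varepsilon_j$, and define the modular $S$-matrix and the fusion coefficients by $$\mathcal S_{\hat\lambda\hat\sigma}=\frac{e^{i\pi n(n-1)/4}}{\sqrt{n(k+n)^{n-1}}}\sum_{w\in S_n}\operatorname{sgn}(w)\,e^{-\frac{2\pi i}{k+n}(\sigma+\rho,\,w(\lambda+\rho))},\qquad \mathcal N_{\hat\lambda\hat\mu}^{\hat\nu}=\sum_{\hat\sigma\in P_k^+}\frac{\mathcal S_{\hat\lambda\hat\sigma}\,\mathcal S_{\hat\mu\hat\sigma}\,\mathcal S_{\hat\nu^*\hat\sigma}}{\mathcal S_{0\hat\sigma}},$$ where the index $0$ stands for the weight $k\hat\omega_0$. Then all $\mathcal N_{\hat\lambda\hat\mu}^{\hat\nu}$ are integers. Let $\mathcal F=\mathcal F(\widehat{\mathfrak{sl}}(n))_k$ be the fusion ring: the free abelian group with basis $P_k^+$, with the bilinear product $\hat\lambda*\hat\mu=\sum_{\hat\nu}\mathcal N_{\hat\lambda\hat\mu}^{\hat\nu}\,\hat\nu$ and unit $k\hat\omega_0$. Let $\Lambda^{(k)}=\mathbb Z[e_1,\dots,e_k]$ be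 the ring of symmetric polynomials in $k$ variables, where $e_r$ and $h_r$ are the elementary and the complete symmetric polynomials of degree $r$ in $k$ variables, and let $s_\mu\in\Lambda^{(k)}$ be the Schur polynomial in $k$ variables, that is, the sum of the monomials $x^T$ over all semistandard tableaux $T$ of shape $\mu$ with entries in $\{1,\dots,k\}$. Then the assignment $\hat\lambda\mapsto s_{\lambda^t}$ defines an isomorphism of (unital) rings $$\mathcal F(\widehat{\mathfrak{sl}}(n))_k\;\cong\;\mathbb Z[e_1,\dots,e_k]\big/\bigl\langle h_n-1,\ h_{n+1},\dots,h_{n+k-1},\ h_{n+k}+(-1)^k e_k\bigr\rangle .$$ -/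

import Mathlib

open scoped BigOperators

noncomputable section

namespace AffineFusion

/-! ## Integrable dominant weights of level `k` -/

/-- The set `P_k^+` of integrable dominant weights `∑ i, m_i ω̂_i` of level `k` of the affine Lie
algebra of type `A_{n-1}^{(1)}`: a weight is given by its Dynkin labels `m_0, …, m_{n-1} ∈ ℕ`, with
`∑ i, m_i = k`.  (The coefficient of the imaginary root `δ` is normalised to be `0`.) -/
abbrev Weight (n k : ℕ) : Type := {m : Fin n → ℕ // ∑ i, m i = k}

instance (n k : ℕ) : Fintype (Weight n k) :=
  Fintype.subtype (Finset.piAntidiag (Finset.univ : Finset (Fin n)) k) (by simp)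

variable {n k : ℕ}

/-- The vacuum weight `k ω̂_0`. -/
def vacuum (n k : ℕ) [NeZero n] : Weight n k :=
  ⟨Pi.single 0 k, by simp⟩

/-- The diagram automorphism `flip`, `m_i ↦ m_{-i}` (indices modulo `n`), which fixes the node `0`
and exchanges the nodes `i` and `n - i`; this sends `ν̂` to the conjugate weight `ν̂^*`. -/
def Weight.conj [NeZero n] (a : Weight n k) : Weight n k :=
  ⟨fun i => a.1 (-i), by
    exact (Fintype.sum_equiv (Equiv.neg (Fin n)) _ _ (fun _ => rfl)).trans a.2⟩

/-! ## The modular S-matrix and the fusion coefficients -/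

/-- The `i`-th fundamental weight `ω_i = ε_1 + ⋯ + ε_i - (i/n) ∑_j ε_j` of `sl(n)`, in the
coordinates `ε_1, …, ε_n` (numbered from `0` here), with `ω_0 = 0`. -/
def fundamentalWeight (n : ℕ) (i : Fin n) : Fin n → ℝ :=
  fun l => (if l < i then 1 else 0) - (i : ℝ) / n

/-- The finite part `∑_{i=1}^{n-1} m_i ω_i` of a weight. -/
def Weight.finitePart (a : Weight n k) : Fin n → ℝ :=
  ∑ i, (a.1 i : ℝ) • fundamentalWeight n i

/-- The Weyl vector `ρ = ∑_j ((n+1)/2 - j) ε_j`, where `j = 1, …, n` is `l + 1` for `l : Fin n`. -/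
def weylVector (n : ℕ) : Fin n → ℝ :=
  fun l => ((n : ℝ) + 1) / 2 - ((l : ℝ) + 1)

/-- The modular S-matrix, given by the Kac-Peterson formula
`S_{λσ} = e^{πi n(n-1)/4} / √(n (k+n)^{n-1}) ∑_{w ∈ S_n} sgn(w) e^{-2πi (σ+ρ, w(λ+ρ)) / (k+n)}`. -/
def modularS (a s : Weight n k) : ℂ :=
  Complex.exp (Real.pi * Complex.I * (n * (n - 1) / 4)) /
      (Real.sqrt ((n : ℝ) * ((k : ℝ) + n) ^ (n - 1)) : ℝ) *
    ∑ w : Equiv.Perm (Fin n), ((Equiv.Perm.sign w : ℤ) : ℂ) *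
      Complex.exp (-(2 * Real.pi * Complex.I / (k + n)) *
        ((∑ j, (s.finitePart + weylVector n) j * (a.finitePart + weylVector n) (w⁻¹ j) : ℝ) : ℂ))

/-- The fusion coefficient `N_{ab}^c = ∑_s S_{as} S_{bs} S_{c^* s} / S_{0s}` (Verlinde formula). -/
def verlindeCoeff [NeZero n] (a b c : Weight n k) : ℂ :=
  ∑ s : Weight n k, modularS a s * modularS b s * modularS c.conj s / modularS (vacuum n k) s

/-- The fusion coefficient as an integer.  (A priori this is the integer nearest to the real part of
the Verlinde sum; that the Verlinde sum is equal to this integer is a claim, to be proved.) -/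
def fusionCoeff [NeZero n] (a b c : Weight n k) : ℤ :=
  round (verlindeCoeff a b c).re

/-! ## The fusion ring -/

/-- The underlying group of the fusion ring at level `k`: the free abelian group on `P_k^+`, an
element being given by its (integer) coordinates. -/
def FusionRing (n k : ℕ) : Type := Weight n k → ℤ

namespace FusionRing

instance : AddCommGroup (FusionRing n k) := inferInstanceAs (AddCommGroup (Weight n k → ℤ))

/-- The basis element of the fusion ring indexed by a weight. -/
def basis (a : Weight n k) : FusionRing n k := Pi.single (M := fun _ => ℤ) a 1

/-- The fusion product, the bilinear extension of `a * b = ∑_c N_{ab}^c c`. -/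
instance [NeZero n] : Mul (FusionRing n k) :=
  ⟨fun x y c => ∑ a, ∑ b, x a * y b * fusionCoeff a b c⟩

theorem mul_apply [NeZero n] (x y : FusionRing n k) (c : Weight n k) :
    (x * y) c = ∑ a, ∑ b, x a * y b * fusionCoeff a b c := rfl

theorem add_apply (x y : FusionRing n k) (c : Weight n k) : (x + y) c = x c + y c := rfl

theorem zero_apply (c : Weight n k) : (0 : FusionRing n k) c = 0 := rfl

theorem basis_mul_basis_apply [NeZero n] (a b c : Weight n k) :
    (basis a * basis b) c = fusionCoeff a b c := by
  classical
  have h : ∀ d e : Weight n k, basis d e = if e = d then 1 else 0 := fun d e => by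
    unfold basis; rw [Pi.single_apply]
  simp [mul_apply, h]

/-- The unit `k ω̂_0`. -/
instance [NeZero n] : One (FusionRing n k) := ⟨basis (vacuum n k)⟩

/-- By construction the product is bilinear.  (Associativity, commutativity and the unit law are not
built in.) -/
instance [NeZero n] : NonUnitalNonAssocRing (FusionRing n k) where
  left_distrib x y z := by
    funext c
    simp only [mul_apply, add_apply, mul_add, add_mul, Finset.sum_add_distrib]
  right_distrib x y z := by
    funext c
    simp only [mul_apply, add_apply, add_mul, Finset.sum_add_distrib]
  zero_mul x := by
    funext c
    simp only [mul_apply, zero_apply, zero_mul, Finset.sum_const_zero]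
  mul_zero x := by
    funext c
    simp only [mul_apply, zero_apply, mul_zero, zero_mul, Finset.sum_const_zero]

end FusionRing

/-! ## The partition of a weight -/

/-- The parts `μ_1 ≥ μ_2 ≥ ⋯ ≥ μ_n = 0` of the partition of a weight, numbered from `0` here; they
are determined by `μ_i - μ_{i+1} = m_i` for `1 ≤ i ≤ n - 1`. -/
def Weight.part (a : Weight n k) (i : ℕ) : ℕ :=
  ∑ j ∈ Finset.univ.filter (fun j : Fin n => i < (j : ℕ)), a.1 j

theorem Weight.part_anti (a : Weight n k) : Antitone a.part := fun i j hij => by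
  refine Finset.sum_le_sum_of_subset fun l hl => ?_
  simp only [Finset.mem_filter, Finset.mem_univ, true_and] at hl ⊢
  omega

theorem Weight.part_le (a : Weight n k) (i : ℕ) : a.part i ≤ k :=
  (Finset.sum_le_sum_of_subset (Finset.filter_subset _ _)).trans a.2.le

theorem Weight.part_eq_zero (a : Weight n k) {i : ℕ} (hi : n ≤ i + 1) : a.part i = 0 := by
  refine Finset.sum_eq_zero fun l hl => ?_
  simp only [Finset.mem_filter, Finset.mem_univ, true_and] at hl
  omega

/-- The Young diagram `λ` of a weight `λ̂`, with at most `n - 1` rows and at most `k` columns: it has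
exactly `m_i` columns of length `i`, for `1 ≤ i ≤ n - 1`. -/
def Weight.diagram (a : Weight n k) : YoungDiagram where
  cells := (Finset.range n ×ˢ Finset.range k).filter (fun c => c.2 < a.part c.1)
  isLowerSet := by
    rintro ⟨i, j⟩ ⟨i', j'⟩ ⟨hi, hj⟩ h
    have hp := a.part_anti hi
    simp only [Finset.coe_filter, Finset.mem_product, Finset.mem_range, Set.mem_ofPred_eq] at *
    omega

theorem Weight.mem_diagram (a : Weight n k) (i j : ℕ) : (i, j) ∈ a.diagram ↔ j < a.part i := by
  have h1 := a.part_le i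
  have h2 := a.part_eq_zero (i := i)
  change (i, j) ∈ Finset.filter _ _ ↔ _
  simp only [Finset.mem_filter, Finset.mem_product, Finset.mem_range]
  omega

/-! ## Schur polynomials and the quotient ring -/

/-- The semistandard tableaux of shape `μ` with entries in `{0, …, k-1}`. -/
abbrev BoundedTableau (μ : YoungDiagram) (k : ℕ) : Type :=
  {T : SemistandardYoungTableau μ // ∀ c ∈ μ.cells, T c.1 c.2 < k}

instance (μ : YoungDiagram) (k : ℕ) : Fintype (BoundedTableau μ k) :=
  haveI : Finite (BoundedTableau μ k) := by
    refine Finite.of_injective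
      (fun T (c : μ.cells) => (⟨T.1 c.1.1 c.1.2, T.2 c.1 c.2⟩ : Fin k)) fun T T' h => ?_
    refine Subtype.ext (SemistandardYoungTableau.ext fun i j => ?_)
    by_cases hc : (i, j) ∈ μ
    · exact congrArg Fin.val (congrFun h ⟨(i, j), hc⟩)
    · rw [T.1.zeros hc, T'.1.zeros hc]
  Fintype.ofFinite _

/-- The Schur polynomial `s_μ` in `k` variables, `∑_T x^T` over the semistandard tableaux `T` of shape
`μ` with entries from a set of size `k`. -/
def schurPoly (k : ℕ) (μ : YoungDiagram) : MvPolynomial (Fin k) ℤ :=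
  ∑ T : BoundedTableau μ k, ∏ c : μ.cells, MvPolynomial.X ⟨T.1 c.1.1 c.1.2, T.2 c.1 c.2⟩

/-- The ring `Λ^{(k)} = ℤ[e_1, …, e_k]` of symmetric polynomials in `k` variables. -/
abbrev SymPoly (k : ℕ) : Type := MvPolynomial.symmetricSubalgebra (Fin k) ℤ

/-- The complete symmetric polynomial `h_r` in `k` variables. -/
def h (k r : ℕ) : SymPoly k :=
  ⟨MvPolynomial.hsymm (Fin k) ℤ r, MvPolynomial.hsymm_isSymmetric (Fin k) ℤ r⟩

/-- The elementary symmetric polynomial `e_r` in `k` variables. -/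
def e (k r : ℕ) : SymPoly k :=
  ⟨MvPolynomial.esymm (Fin k) ℤ r, MvPolynomial.esymm_isSymmetric (Fin k) ℤ r⟩

/-- The ideal `⟨h_n - 1, h_{n+1}, …, h_{n+k-1}, h_{n+k} + (-1)^k e_k⟩`. -/
def fusionIdeal (n k : ℕ) : Ideal (SymPoly k) :=
  Ideal.span ({h k n - 1} ∪ {p | ∃ i, 1 ≤ i ∧ i < k ∧ p = h k (n + i)} ∪
    {h k (n + k) + (-1) ^ k * e k k})

end AffineFusion

end

open scoped BigOperators

noncomputable section

namespace AffineFusion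

variable {n k : ℕ}

/-! ## Determinants of powers and their branching rule -/

/-! Put N = n + k. A weight σ is recorded by its exponents, an n-element subset of {0, …, N-1}
containing 0; up to a common shift they are the coordinates of σ + ρ. They give n complex numbers
y_i (`Weight.point`) with product 1. The k remaining elements of {0, …, N-1} give, by the same
exponential and an added minus sign, a point x(σ) of ℂ^k (`Weight.copoint`).

Values. S_{λσ} is a constant times the alternant in y with the exponents of λ (`modularS_eq`). The
numbers attached to all of {0, …, N-1} are the N-th roots of one number of modulus 1, so their
matrix of powers is √N times a unitary matrix. Jacobi's identity for complementary minors turns the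
alternant in y for λ into an alternant in x(σ) for λ^t. With the bialternant formula
(`tableauSum_mul_det`) this gives s_{λ^t}(x(σ)) = S_{λσ} / S_{0σ} (`eval_schur`).

Relations. The product of 1 + ζt over the N roots ζ is 1 - c t^N for a constant c. Hence the
generating function H of the h_r at x(σ) satisfies H(t) (1 - c t^N) = ∏ (1 + y_i t), and all
generators of the ideal vanish at x(σ) (`evalAt_eq_zero`).

Spanning. A symmetric f is the antisymmetrization of f x^δ divided by the Vandermonde determinant.
Modulo the ideal, x_i^(n+k-1) can be replaced by ± the product of the other variables, which lowers
the degree until only Schur polynomials of weights remain (`monom_mem`,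
`exists_sub_mem_fusionIdeal`).

Conclusion. Modulo the ideal, a product of two Schur polynomials of weights is an integer
combination of such polynomials. Evaluating at every x(σ) and inverting S by orthogonality
(`sum_modularS_mul`) shows that the coefficients are the Verlinde sums. This gives integrality and
multiplicativity; the same inversion gives injectivity, and spanning gives surjectivity. -/

theorem det_pow_branching {A : Type*} [CommRing A] {k : ℕ} (v : Fin (k + 1) → A)
    (l : Fin (k + 1) → ℕ) (hl : Monotone l) :
    (Matrix.of fun i j => v j ^ l i).det =
      v 0 ^ l 0 * (∏ j : Fin k, (v j.succ - v 0)) *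
        ∑ m ∈ Fintype.piFinset (fun i : Fin k => Finset.Ico (l i.castSucc) (l i.succ)),
          (∏ i, v 0 ^ (l i.succ - 1 - m i)) * (Matrix.of fun i j : Fin k => v j.succ ^ m i).det := by
  classical
  -- Subtracting from each row a power of `v 0` times the preceding row clears the first column
  -- below its top entry. Each remaining entry is then `v j.succ - v 0` times a geometric sum, and
  -- expanding multilinearly in the rows gives the sum over interlacing exponents `m`.
  rw [Matrix.det_eq_of_forall_row_eq_smul_add_pred
    (B := Matrix.of fun i j => (Fin.cases (v j ^ l 0) (fun i' : Fin k => v j ^ l i'.succ -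
      v 0 ^ (l i'.succ - l i'.castSucc) * v j ^ l i'.castSucc) i : A))
    (fun i => v 0 ^ (l i.succ - l i.castSucc)) (fun j => by simp) (fun i j => by simp)]
  rw [Matrix.det_succ_column_zero, Fin.sum_univ_succ, Finset.sum_eq_zero, add_zero]
  · have hsub : ((Matrix.of fun i j => (Fin.cases (v j ^ l 0) (fun i' : Fin k => v j ^ l i'.succ -
        v 0 ^ (l i'.succ - l i'.castSucc) * v j ^ l i'.castSucc) i : A)).submatrix
          (Fin.succAbove 0) Fin.succ) =
        Matrix.of fun i j : Fin k => (v j.succ - v 0) * (fun (i : Fin k) =>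
          ∑ m ∈ Finset.Ico (l i.castSucc) (l i.succ),
            fun j : Fin k => v 0 ^ (l i.succ - 1 - m) * v j.succ ^ m) i j := by
      ext i j
      have h := mul_geom_sum₂_Ico (v j.succ) (v 0) (hl (Fin.castSucc_lt_succ (i := i)).le)
      simp only [Fin.succAbove_zero, Matrix.submatrix_apply, Matrix.of_apply, Fin.cases_succ,
        Finset.sum_apply]
      rw [Finset.sum_congr rfl (fun m _ => mul_comm (v 0 ^ (l i.succ - 1 - m)) (v j.succ ^ m)), h]
      ring
    rw [hsub]
    have h2 := Matrix.det_mul_row (fun j : Fin k => v j.succ - v 0)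
      (Matrix.of fun (i : Fin k) => (∑ m ∈ Finset.Ico (l i.castSucc) (l i.succ),
            fun j : Fin k => v 0 ^ (l i.succ - 1 - m) * v j.succ ^ m))
    simp only [Matrix.of_apply] at h2 ⊢
    rw [h2]
    have h3 := (Matrix.detRowAlternating (n := Fin k) (R := A)).toMultilinearMap.map_sum_finset
      (fun (i : Fin k) (m : ℕ) => fun j : Fin k => v 0 ^ (l i.succ - 1 - m) * v j.succ ^ m)
      (fun i => Finset.Ico (l i.castSucc) (l i.succ))
    change Matrix.det _ = ∑ r ∈ _, Matrix.det _ at h3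
    rw [show (Matrix.of fun (i : Fin k) => (∑ m ∈ Finset.Ico (l i.castSucc) (l i.succ),
            fun j : Fin k => v 0 ^ (l i.succ - 1 - m) * v j.succ ^ m)).det = _ from h3]
    simp only [Fin.val_zero, pow_zero, one_mul, Fin.cases_zero, mul_assoc]
    congr 2
    refine Finset.sum_congr rfl fun m _ => ?_
    exact Matrix.det_mul_column (fun i => v 0 ^ (l i.succ - 1 - m i))
      (Matrix.of fun i j : Fin k => v j.succ ^ m i)
  · intro i _
    have hi : l i.castSucc ≤ l i.succ := hl (Fin.castSucc_lt_succ (i := i)).le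
    simp [← pow_add, Nat.sub_add_cancel hi]

/-! ## Tableaux and their branching rule -/

theorem lt_card_filter_iff {L : ℕ} {p : ℕ → Prop} [DecidablePred p]
    (hp : ∀ i j, i ≤ j → j < L → p j → p i) {j : ℕ} (hj : j < L) :
    p j ↔ j < ((Finset.range L).filter p).card := by
  constructor
  · intro h
    have : Finset.range (j + 1) ⊆ (Finset.range L).filter p := fun i hi => by
      simp only [Finset.mem_range, Finset.mem_filter] at *
      exact ⟨by omega, hp i j (by omega) hj h⟩
    simpa using Finset.card_le_card this
  · intro h
    by_contra hn
    have : (Finset.range L).filter p ⊆ Finset.range j := fun i hi => by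
      simp only [Finset.mem_range, Finset.mem_filter] at *
      by_contra hij
      exact hn (hp j i (by omega) hi.1 hi.2)
    have := Finset.card_le_card this
    simp only [Finset.card_range] at this
    omega

/-- The largest Young diagram with at most `k` rows whose `i`-th row has length at most `s i`. -/
def ofRowFun {k : ℕ} (s : Fin k → ℕ) : YoungDiagram where
  cells := (Finset.univ.biUnion fun i : Fin k =>
    (Finset.range (s i)).image fun j => ((i : ℕ), j)).filter
      fun c => ∀ i : Fin k, (i : ℕ) ≤ c.1 → c.2 < s i
  isLowerSet := by
    rintro ⟨i, j⟩ ⟨i', j'⟩ ⟨hi, hj⟩ h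
    simp only [Finset.coe_filter, Finset.mem_biUnion, Finset.mem_univ, Finset.mem_image,
      Finset.mem_range, true_and, Set.mem_ofPred_eq, Prod.mk.injEq] at *
    obtain ⟨⟨a, b, hb, rfl, rfl⟩, h2⟩ := h
    have hlt := a.2
    have h3 := h2 ⟨i', by omega⟩ hi
    exact ⟨⟨⟨i', by omega⟩, j', by omega, rfl, rfl⟩,
      fun l hl => lt_of_le_of_lt hj (h2 l (by omega))⟩

theorem mem_ofRowFun {k : ℕ} {s : Fin k → ℕ} (hs : Antitone s) {i j : ℕ} :
    (i, j) ∈ ofRowFun s ↔ ∃ h : i < k, j < s ⟨i, h⟩ := by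
  rw [← YoungDiagram.mem_cells]
  change _ ∈ Finset.filter _ _ ↔ _
  simp only [Finset.mem_filter, Finset.mem_biUnion, Finset.mem_univ, Finset.mem_image,
    Finset.mem_range, true_and, Prod.mk.injEq]
  constructor
  · rintro ⟨⟨a, b, hb, rfl, rfl⟩, _⟩
    exact ⟨a.2, hb⟩
  · rintro ⟨h, hj⟩
    exact ⟨⟨⟨i, h⟩, j, hj, rfl, rfl⟩, fun l hl => lt_of_lt_of_le hj (hs hl)⟩

theorem rowLen_ofRowFun {k : ℕ} {s : Fin k → ℕ} (hs : Antitone s) (i : Fin k) :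
    (ofRowFun s).rowLen i = s i := by
  refine eq_of_forall_lt_iff fun j => ?_
  rw [← YoungDiagram.mem_iff_lt_rowLen, mem_ofRowFun hs]
  simp

theorem colLen_ofRowFun_le {k : ℕ} {s : Fin k → ℕ} (hs : Antitone s) :
    (ofRowFun s).colLen 0 ≤ k := by
  by_contra h
  have := (mem_ofRowFun hs).1 (YoungDiagram.mem_iff_lt_colLen.2 (not_le.1 h))
  exact absurd this.1 (lt_irrefl _)

theorem rowLen_eq_zero {μ : YoungDiagram} {k i : ℕ} (h : μ.colLen 0 ≤ k) (hi : k ≤ i) :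
    μ.rowLen i = 0 := by
  by_contra h0
  have := YoungDiagram.mem_iff_lt_colLen.1
    (YoungDiagram.mem_iff_lt_rowLen.2 (Nat.pos_of_ne_zero h0))
  omega

theorem prod_cells {A : Type*} [CommMonoid A] {μ : YoungDiagram} {k : ℕ} (h : μ.colLen 0 ≤ k)
    (f : ℕ → ℕ → A) :
    ∏ c ∈ μ.cells, f c.1 c.2 = ∏ i : Fin k, ∏ j ∈ Finset.range (μ.rowLen i), f i j := by
  rw [Fin.prod_univ_eq_prod_range (fun i => ∏ j ∈ Finset.range (μ.rowLen i), f i j) k]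
  refine Finset.prod_finset_product _ _ _ fun p => ?_
  rw [YoungDiagram.mem_cells, show p = (p.1, p.2) from rfl, YoungDiagram.mem_iff_lt_rowLen]
  simp only [Finset.mem_range, iff_and_self]
  intro hp
  by_contra h1
  rw [rowLen_eq_zero h (not_lt.1 h1)] at hp
  omega

/-- The generating function of the semistandard tableaux with entries in `{0, …, k-1}`. -/
def tableauSum {A : Type*} [CommRing A] (x : ℕ → A) (k : ℕ) (μ : YoungDiagram) : A :=
  ∑ T : BoundedTableau μ k, ∏ c ∈ μ.cells, x (T.1 c.1 c.2)

/-- The lengths of the rows of the part of a tableau with entries less than `k`. -/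
def smallRows {μ : YoungDiagram} (k : ℕ) (T : SemistandardYoungTableau μ) (i : Fin k) : ℕ :=
  ((Finset.range (μ.rowLen i)).filter fun j => T i j < k).card

theorem lt_smallRows_iff {μ : YoungDiagram} {k : ℕ} (T : SemistandardYoungTableau μ) (i : Fin k)
    {j : ℕ} (hj : j < μ.rowLen i) : T i j < k ↔ j < smallRows k T i :=
  lt_card_filter_iff (p := fun j => T i j < k)
    (fun _ _ hab hb hlt => (T.row_weak_of_le hab (YoungDiagram.mem_iff_lt_rowLen.2 hb)).trans_lt hlt)
    hj

theorem smallRows_le {μ : YoungDiagram} {k : ℕ} (T : SemistandardYoungTableau μ) (i : Fin k) :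
    smallRows k T i ≤ μ.rowLen i :=
  (Finset.card_filter_le _ _).trans (Finset.card_range _).le

/-- Interlacing comes from column strictness: directly above an entry of row i + 1, which is at most
k, stands an entry less than k. -/
theorem smallRows_mem {μ : YoungDiagram} {k : ℕ} (T : BoundedTableau μ (k + 1)) :
    smallRows k T.1 ∈ Fintype.piFinset
      (fun i : Fin k => Finset.Icc (μ.rowLen (i + 1)) (μ.rowLen i)) := by
  simp only [Fintype.mem_piFinset, Finset.mem_Icc]
  refine fun i => ⟨?_, smallRows_le _ _⟩
  refine le_of_forall_lt fun j hj => ?_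
  have hm : ((i : ℕ) + 1, j) ∈ μ := YoungDiagram.mem_iff_lt_rowLen.2 hj
  have h1 := T.1.col_strict (Nat.lt_add_one (i : ℕ)) hm
  have h2 := T.2 (i + 1, j) ((YoungDiagram.mem_cells _).2 hm)
  simp only at h2
  exact (lt_smallRows_iff T.1 i (hj.trans_le (μ.rowLen_anti _ _ (Nat.le_succ _)))).1 (by omega)

theorem antitone_of_interlacing {μ : YoungDiagram} {k : ℕ} {s : Fin k → ℕ}
    (hs : s ∈ Fintype.piFinset (fun i : Fin k => Finset.Icc (μ.rowLen (i + 1)) (μ.rowLen i))) :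
    Antitone s := by
  simp only [Fintype.mem_piFinset, Finset.mem_Icc] at hs
  intro i j hij
  rcases hij.eq_or_lt with rfl | h
  · exact le_rfl
  · exact (hs j).2.trans ((μ.rowLen_anti _ _ (by exact h)).trans (hs i).1)

/-- The restriction of a tableau to its entries less than `k`. -/
def restrictTableau {μ : YoungDiagram} {k : ℕ} {s : Fin k → ℕ} (hs : Antitone s)
    (hsμ : ∀ i, s i ≤ μ.rowLen i) (T : SemistandardYoungTableau μ) (hT : smallRows k T = s) :
    BoundedTableau (ofRowFun s) k :=
  have hsub : ∀ {i j}, (i, j) ∈ ofRowFun s → (i, j) ∈ μ := fun {i j} h => by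
    obtain ⟨hi, hj⟩ := (mem_ofRowFun hs).1 h
    exact YoungDiagram.mem_iff_lt_rowLen.2 (hj.trans_le (hsμ _))
  ⟨{ entry := fun i j => if (i, j) ∈ ofRowFun s then T i j else 0
     row_weak' := fun hj hc => by
      rw [if_pos hc, if_pos ((ofRowFun s).up_left_mem le_rfl hj.le hc)]
      exact T.row_weak hj (hsub hc)
     col_strict' := fun hi hc => by
      rw [if_pos hc, if_pos ((ofRowFun s).up_left_mem hi.le le_rfl hc)]
      exact T.col_strict hi (hsub hc)
     zeros' := fun h => if_neg h },
  fun c hc => by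
    have hc' := (YoungDiagram.mem_cells _).1 hc
    change (if (c.1, c.2) ∈ ofRowFun s then T c.1 c.2 else 0) < k
    rw [if_pos hc']
    obtain ⟨hi, hj⟩ := (mem_ofRowFun hs).1 hc'
    subst hT
    exact (lt_smallRows_iff T ⟨c.1, hi⟩ (hj.trans_le (hsμ _))).2 hj⟩

/-- The extension of a tableau by the entry `k` to a larger, interlacing, diagram. -/
def extendTableau {μ : YoungDiagram} {k : ℕ} {s : Fin k → ℕ} (hμ : μ.colLen 0 ≤ k + 1)
    (hs : s ∈ Fintype.piFinset (fun i : Fin k => Finset.Icc (μ.rowLen (i + 1)) (μ.rowLen i)))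
    (T : BoundedTableau (ofRowFun s) k) : BoundedTableau μ (k + 1) :=
  have ha := antitone_of_interlacing hs
  have hb : ∀ {i j}, (i, j) ∈ ofRowFun s → T.1 i j < k := fun h =>
    T.2 _ ((YoungDiagram.mem_cells _).2 h)
  have hsub : ∀ {i j}, (i, j) ∈ ofRowFun s → (i, j) ∈ μ := fun {i j} h => by
    obtain ⟨hi, hj⟩ := (mem_ofRowFun ha).1 h
    simp only [Fintype.mem_piFinset, Finset.mem_Icc] at hs
    exact YoungDiagram.mem_iff_lt_rowLen.2 (hj.trans_le (hs _).2)
  -- By interlacing, a cell with a cell of `μ` below it lies in the smaller diagram. So the added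
  -- cells form a horizontal strip, and filling them all with `k` keeps the columns strict.
  have hup : ∀ {i₁ i₂ j}, i₁ < i₂ → (i₂, j) ∈ μ → (i₁, j) ∈ ofRowFun s := fun {i₁ i₂ j} hi h => by
    have h1 : i₂ < k + 1 := lt_of_lt_of_le
      (YoungDiagram.mem_iff_lt_colLen.1 (μ.up_left_mem le_rfl (Nat.zero_le _) h)) hμ
    simp only [Fintype.mem_piFinset, Finset.mem_Icc] at hs
    refine (mem_ofRowFun ha).2 ⟨by omega, ?_⟩
    exact ((YoungDiagram.mem_iff_lt_rowLen.1 h).trans_le (μ.rowLen_anti _ _ hi)).trans_le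
      (hs ⟨i₁, by omega⟩).1
  ⟨{ entry := fun i j => if (i, j) ∈ ofRowFun s then T.1 i j else if (i, j) ∈ μ then k else 0
     row_weak' := fun {i j₁ j₂} hj hc => by
      have hc1 : (i, j₁) ∈ μ := μ.up_left_mem le_rfl hj.le hc
      by_cases h2 : (i, j₂) ∈ ofRowFun s
      · rw [if_pos h2, if_pos ((ofRowFun s).up_left_mem le_rfl hj.le h2)]
        exact T.1.row_weak hj h2
      · rw [if_neg h2, if_pos hc, if_pos hc1]
        split_ifs with h1
        · exact (hb h1).le
        · exact le_rfl
     col_strict' := fun {i₁ i₂ j} hi hc => by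
      rw [if_pos (hup hi hc), if_pos hc]
      split_ifs with h2
      · exact T.1.col_strict hi h2
      · exact hb (hup hi hc)
     zeros' := fun {i j} h => by
      rw [if_neg (fun h' => h (hsub h')), if_neg h] },
  fun c hc => by
    change (if (c.1, c.2) ∈ ofRowFun s then T.1 c.1 c.2 else if (c.1, c.2) ∈ μ then k else 0) < k + 1
    split_ifs with h1
    · exact (hb h1).trans (Nat.lt_succ_self _)
    all_goals omega⟩

theorem extendTableau_apply {μ : YoungDiagram} {k : ℕ} {s : Fin k → ℕ} (hμ : μ.colLen 0 ≤ k + 1)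
    (hs : s ∈ Fintype.piFinset (fun i : Fin k => Finset.Icc (μ.rowLen (i + 1)) (μ.rowLen i)))
    (T : BoundedTableau (ofRowFun s) k) (i j : ℕ) :
    (extendTableau hμ hs T).1 i j =
      if (i, j) ∈ ofRowFun s then T.1 i j else if (i, j) ∈ μ then k else 0 := rfl

theorem restrictTableau_apply {μ : YoungDiagram} {k : ℕ} {s : Fin k → ℕ} (hs : Antitone s)
    (hsμ : ∀ i, s i ≤ μ.rowLen i) (T : SemistandardYoungTableau μ) (hT : smallRows k T = s)
    (i j : ℕ) :
    (restrictTableau hs hsμ T hT).1 i j = if (i, j) ∈ ofRowFun s then T i j else 0 := rfl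

theorem smallRows_extendTableau {μ : YoungDiagram} {k : ℕ} {s : Fin k → ℕ}
    (hμ : μ.colLen 0 ≤ k + 1)
    (hs : s ∈ Fintype.piFinset (fun i : Fin k => Finset.Icc (μ.rowLen (i + 1)) (μ.rowLen i)))
    (T : BoundedTableau (ofRowFun s) k) : smallRows k (extendTableau hμ hs T).1 = s := by
  have ha := antitone_of_interlacing hs
  funext i
  have hsi : s i ≤ μ.rowLen i := by
    simp only [Fintype.mem_piFinset, Finset.mem_Icc] at hs
    exact (hs i).2
  unfold smallRows
  rw [show (Finset.range (μ.rowLen i)).filter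
      (fun j => (extendTableau hμ hs T).1 i j < k) = Finset.range (s i) from ?_, Finset.card_range]
  ext j
  rw [Finset.mem_filter, Finset.mem_range, extendTableau_apply]
  have hm : ((i : ℕ), j) ∈ ofRowFun s ↔ j < s i := by simp [mem_ofRowFun ha]
  simp only [hm, YoungDiagram.mem_iff_lt_rowLen, Finset.mem_range]
  constructor
  · rintro ⟨h1, h2⟩
    by_contra h3
    rw [if_neg h3, if_pos h1] at h2
    omega
  · intro h
    exact ⟨h.trans_le hsi, by rw [if_pos h]; exact T.2 _ ((YoungDiagram.mem_cells _).2 (hm.2 h))⟩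

theorem prod_cells_extendTableau {A : Type*} [CommRing A] (x : ℕ → A) {μ : YoungDiagram} {k : ℕ}
    {s : Fin k → ℕ} (hμ : μ.colLen 0 ≤ k + 1)
    (hs : s ∈ Fintype.piFinset (fun i : Fin k => Finset.Icc (μ.rowLen (i + 1)) (μ.rowLen i)))
    (T : BoundedTableau (ofRowFun s) k) :
    ∏ c ∈ μ.cells, x ((extendTableau hμ hs T).1 c.1 c.2) =
      x k ^ μ.rowLen k * (∏ i : Fin k, x k ^ (μ.rowLen i - s i)) *
        ∏ c ∈ (ofRowFun s).cells, x (T.1 c.1 c.2) := by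
  have ha := antitone_of_interlacing hs
  rw [prod_cells hμ (fun i j => x ((extendTableau hμ hs T).1 i j)),
    prod_cells (colLen_ofRowFun_le ha) (fun i j => x (T.1 i j)), Fin.prod_univ_castSucc]
  simp only [Fin.val_last, Fin.val_castSucc]
  rw [mul_comm, mul_assoc, ← Finset.prod_mul_distrib]
  congr 1
  · rw [Finset.prod_congr rfl (g := fun _ => x k), Finset.prod_const, Finset.card_range]
    intro j hj
    rw [extendTableau_apply, if_neg, if_pos]
    · exact YoungDiagram.mem_iff_lt_rowLen.2 (Finset.mem_range.1 hj)
    · simp [mem_ofRowFun ha]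
  · refine Finset.prod_congr rfl fun i _ => ?_
    have hsi : s i ≤ μ.rowLen i := by
      simp only [Fintype.mem_piFinset, Finset.mem_Icc] at hs
      exact (hs i).2
    rw [rowLen_ofRowFun ha, ← Finset.prod_range_mul_prod_Ico _ hsi, mul_comm]
    congr 1
    · rw [Finset.prod_congr rfl (g := fun _ => x k), Finset.prod_const, Nat.card_Ico]
      intro j hj
      rw [Finset.mem_Ico] at hj
      rw [extendTableau_apply, if_neg, if_pos]
      · exact YoungDiagram.mem_iff_lt_rowLen.2 hj.2
      · simp [mem_ofRowFun ha, hj.1]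
    · refine Finset.prod_congr rfl fun j hj => ?_
      rw [extendTableau_apply, if_pos]
      simpa [mem_ofRowFun ha] using hj

/-- A tableau is determined by its part with entries less than k, since all other cells contain k.
Sorting tableaux by the shape of that part gives a recursion parallel to `det_pow_branching`. -/
theorem tableauSum_succ {A : Type*} [CommRing A] (x : ℕ → A) {μ : YoungDiagram} {k : ℕ}
    (hμ : μ.colLen 0 ≤ k + 1) :
    tableauSum x (k + 1) μ =
      ∑ s ∈ Fintype.piFinset (fun i : Fin k => Finset.Icc (μ.rowLen (i + 1)) (μ.rowLen i)),
        x k ^ μ.rowLen k * (∏ i : Fin k, x k ^ (μ.rowLen i - s i)) *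
          tableauSum x k (ofRowFun s) := by
  classical
  unfold tableauSum
  rw [← Finset.sum_fiberwise_of_maps_to (g := fun T : BoundedTableau μ (k + 1) => smallRows k T.1)
    (fun T _ => smallRows_mem T)]
  refine Finset.sum_congr rfl fun s hs => ?_
  have ha := antitone_of_interlacing hs
  have hsμ : ∀ i, s i ≤ μ.rowLen i := fun i => by
    simp only [Fintype.mem_piFinset, Finset.mem_Icc] at hs
    exact (hs i).2
  rw [Finset.mul_sum]
  symm
  refine Finset.sum_bij' (fun T _ => extendTableau hμ hs T)
    (fun T hT => restrictTableau ha hsμ T.1 (Finset.mem_filter.1 hT).2) ?_ ?_ ?_ ?_ ?_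
  · intro T _
    exact Finset.mem_filter.2 ⟨Finset.mem_univ _, smallRows_extendTableau hμ hs T⟩
  · intro T _
    exact Finset.mem_univ _
  · intro T _
    refine Subtype.ext (SemistandardYoungTableau.ext fun i j => ?_)
    rw [restrictTableau_apply, extendTableau_apply]
    split_ifs with h
    · rfl
    · exact (T.1.zeros h).symm
  · intro T hT
    have hT' := (Finset.mem_filter.1 hT).2
    refine Subtype.ext (SemistandardYoungTableau.ext fun i j => ?_)
    rw [extendTableau_apply, restrictTableau_apply]
    split_ifs with h1 h2
    · rfl
    · have hlt := T.2 _ ((YoungDiagram.mem_cells _).2 h2)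
      simp only at hlt
      by_contra hne
      have hlt' : T.1 i j < k := by omega
      have hik : i < k := by
        by_contra hik
        -- Columns increase strictly from at least 0, so an entry in row i is at least i; an entry
        -- less than `k` therefore lies in one of the first `k` rows.
        have : ∀ i, (i, j) ∈ μ → i ≤ T.1 i j := by
          intro i
          induction i with
          | zero => intro _; exact Nat.zero_le _
          | succ i ih =>
            intro hm
            have := ih (μ.up_left_mem (Nat.le_succ _) le_rfl hm)
            have := T.1.col_strict (Nat.lt_add_one i) hm
            omega
        have := this i h2
        omega
      refine h1 ((mem_ofRowFun ha).2 ⟨hik, ?_⟩)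
      have := (lt_smallRows_iff T.1 ⟨i, hik⟩ (YoungDiagram.mem_iff_lt_rowLen.1 h2)).1 hlt'
      rwa [hT'] at this
    · exact (T.1.zeros h2).symm
  · intro T _
    exact (prod_cells_extendTableau x hμ hs T).symm

theorem tableauSum_zero {A : Type*} [CommRing A] (x : ℕ → A) {μ : YoungDiagram}
    (hμ : μ.colLen 0 ≤ 0) : tableauSum x 0 μ = 1 := by
  have h0 : ∀ i j, (i, j) ∉ μ := fun i j h => by
    have := YoungDiagram.mem_iff_lt_rowLen.1 h
    rw [rowLen_eq_zero hμ (Nat.zero_le _)] at this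
    omega
  have hc : μ.cells = ∅ := by
    ext c
    simp only [YoungDiagram.mem_cells, Finset.notMem_empty, iff_false]
    exact h0 _ _
  have hu : Subsingleton (BoundedTableau μ 0) := ⟨fun T T' => Subtype.ext
    (SemistandardYoungTableau.ext fun i j => by rw [T.1.zeros (h0 i j), T'.1.zeros (h0 i j)])⟩
  let T₀ : BoundedTableau μ 0 := ⟨SemistandardYoungTableau.highestWeight μ, by simp [hc]⟩
  unfold tableauSum
  rw [Fintype.sum_subsingleton _ T₀]
  simp [hc]

/-- The bialternant formula for Schur polynomials. -/
theorem tableauSum_mul_det {A : Type*} [CommRing A] (x : ℕ → A) (k : ℕ) (μ : YoungDiagram)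
    (hμ : μ.colLen 0 ≤ k) :
    tableauSum x k μ * (Matrix.of fun i j : Fin k => x j.rev ^ (i : ℕ)).det =
      (Matrix.of fun i j : Fin k => x j.rev ^ (μ.rowLen i.rev + i)).det := by
  induction k generalizing μ with
  | zero => simp [tableauSum_zero x hμ]
  | succ k ih =>
    -- With the variables reversed, `x k` is the variable `v 0` split off by the branching rule, and
    -- the others are again in reversed order.
    have hv : ∀ j : Fin k, x ((Fin.succ j).rev : Fin (k + 1)) = x j.rev := fun j => by
      congr 1
      simp [Fin.val_rev]
    have h1 := det_pow_branching (fun j : Fin (k + 1) => x j.rev)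
      (fun i => (i : ℕ)) (fun i j h => h)
    have h2 := det_pow_branching (fun j : Fin (k + 1) => x j.rev)
      (fun i => μ.rowLen i.rev + i) (by
        refine Fin.monotone_iff_le_succ.2 fun i => ?_
        have := μ.rowLen_anti (Fin.succ i).rev (Fin.castSucc i).rev (by
          simp only [Fin.val_rev, Fin.val_succ, Fin.val_castSucc]; omega)
        simp only [Fin.val_succ, Fin.val_castSucc]
        omega)
    rw [h1, h2, tableauSum_succ x hμ]
    -- For consecutive exponents the interlacing sequence is forced, so the denominator branches
    -- into a single term.
    have hsingle : Fintype.piFinset (fun i : Fin k =>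
        Finset.Ico ((Fin.castSucc i : Fin (k + 1)) : ℕ) ((Fin.succ i : Fin (k + 1)) : ℕ)) =
        {fun i : Fin k => (i : ℕ)} := by
      ext m
      simp only [Fintype.mem_piFinset, Finset.mem_Ico, Finset.mem_singleton, funext_iff,
        Fin.val_castSucc, Fin.val_succ]
      exact forall_congr' fun i => by omega
    rw [hsingle, Finset.sum_singleton]
    simp only [hv, Fin.val_zero, pow_zero, one_mul, Fin.rev_zero, Fin.val_last, Fin.val_succ,
      Nat.add_sub_cancel, Nat.sub_self, Finset.prod_const_one, add_zero]
    rw [mul_left_comm, mul_comm (x k ^ μ.rowLen k), mul_assoc]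
    congr 1
    rw [Finset.sum_mul, Finset.mul_sum]
    -- Adding the staircase turns weak interlacing of row lengths into the half-open interlacing of
    -- exponents.
    refine Finset.sum_bij' (fun s _ i => s i.rev + i) (fun m _ i => m i.rev - (i.rev : ℕ)) ?_ ?_ ?_ ?_ ?_
    · intro s hs
      simp only [Fintype.mem_piFinset, Finset.mem_Icc, Finset.mem_Ico] at hs ⊢
      intro i
      have := hs i.rev
      have e1 : ((Fin.castSucc i).rev : ℕ) = i.rev + 1 := by
        simp only [Fin.val_rev, Fin.val_castSucc]; omega
      have e2 : ((Fin.succ i).rev : ℕ) = i.rev := by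
        simp only [Fin.val_rev, Fin.val_succ]; omega
      rw [e1, e2, Fin.val_castSucc]
      omega
    · intro m hm
      simp only [Fintype.mem_piFinset, Finset.mem_Icc, Finset.mem_Ico] at hm ⊢
      intro i
      have := hm i.rev
      have e1 : ((Fin.castSucc i.rev).rev : ℕ) = i + 1 := by
        simp only [Fin.val_rev, Fin.val_castSucc]; omega
      have e2 : ((Fin.succ i.rev).rev : ℕ) = i := by
        simp only [Fin.val_rev, Fin.val_succ]; omega
      rw [e1, e2, Fin.val_castSucc] at this
      omega
    · intro s _
      funext i
      simp
    · intro m hm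
      simp only [Fintype.mem_piFinset, Finset.mem_Ico] at hm
      funext i
      have := hm i
      rw [Fin.val_castSucc] at this
      simp only [Fin.rev_rev]
      omega
    · intro s hs
      have ha := antitone_of_interlacing hs
      have hih := ih (ofRowFun s) (colLen_ofRowFun_le ha)
      simp only [rowLen_ofRowFun ha] at hih
      rw [mul_assoc, hih, mul_assoc]
      congr 2
      rw [← Equiv.prod_comp Fin.revPerm]
      refine Finset.prod_congr rfl fun i _ => ?_
      congr 1
      simp only [Fin.revPerm_apply]
      have e2 : ((Fin.succ i).rev : ℕ) = i.rev := by
        simp only [Fin.val_rev, Fin.val_succ]; omega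
      rw [e2]
      omega

/-! ## Schur polynomials as quotients of alternants -/

/-- The alternant `det (x_j ^ l_i)`. -/
def alternant {A : Type*} [CommRing A] (x : Fin k → A) (l : Fin k → ℕ) : A :=
  (Matrix.of fun i j : Fin k => x j ^ l i).det

theorem alternant_comp_perm {A : Type*} [CommRing A] (x : Fin k → A) (l : Fin k → ℕ)
    (w : Equiv.Perm (Fin k)) :
    alternant x (l ∘ w) = ((Equiv.Perm.sign w : ℤ) : A) * alternant x l :=
  Matrix.det_permute w (Matrix.of fun i j : Fin k => x j ^ l i)

theorem alternant_perm_comp {A : Type*} [CommRing A] (x : Fin k → A) (l : Fin k → ℕ)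
    (w : Equiv.Perm (Fin k)) :
    alternant (x ∘ w) l = ((Equiv.Perm.sign w : ℤ) : A) * alternant x l :=
  Matrix.det_permute' w (Matrix.of fun i j : Fin k => x j ^ l i)

theorem map_alternant {A B : Type*} [CommRing A] [CommRing B] (f : A →+* B) (x : Fin k → A)
    (l : Fin k → ℕ) : f (alternant x l) = alternant (f ∘ x) l := by
  unfold alternant
  rw [RingHom.map_det]
  congr 1
  ext i j
  simp

theorem alternant_eq_zero {A : Type*} [CommRing A] (x : Fin k → A) {l : Fin k → ℕ}
    (hl : ¬ Function.Injective l) : alternant x l = 0 := by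
  simp only [Function.Injective, not_forall] at hl
  obtain ⟨i, j, h, hij⟩ := hl
  refine Matrix.det_zero_of_row_eq hij ?_
  funext m
  simp [h]

theorem sign_mul_sign (w : Equiv.Perm (Fin k)) {A : Type*} [CommRing A] (a : A) :
    ((Equiv.Perm.sign w : ℤ) : A) * (((Equiv.Perm.sign w : ℤ) : A) * a) = a := by
  rw [← mul_assoc, ← Int.cast_mul, ← Units.val_mul, Int.units_mul_self]
  simp

/-- The exponents `k - 1, …, 1, 0`. -/
def stair (k : ℕ) (i : Fin k) : ℕ := i.rev

theorem alternant_stair_ne_zero {A : Type*} [CommRing A] [IsDomain A] {x : Fin k → A}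
    (hx : Function.Injective x) : alternant x (stair k) ≠ 0 := by
  have h : alternant x (stair k) =
      ((Equiv.Perm.sign (Fin.revPerm : Equiv.Perm (Fin k)) : ℤ) : A) *
        (Matrix.vandermonde x).det := by
    have := alternant_comp_perm x (fun i : Fin k => (i : ℕ)) Fin.revPerm
    rw [show stair k = (fun i : Fin k => (i : ℕ)) ∘ Fin.revPerm from rfl, this]
    congr 1
    rw [← Matrix.det_transpose]
    rfl
  intro h0
  have h1 := sign_mul_sign (Fin.revPerm : Equiv.Perm (Fin k)) (Matrix.vandermonde x).det
  rw [← h, h0, mul_zero] at h1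
  exact Matrix.det_vandermonde_ne_zero_iff.2 hx h1.symm

/-- The value 0 at indices from k on is a placeholder, never reached by a bounded tableau. -/
theorem map_schurPoly {A : Type*} [CommRing A] (f : MvPolynomial (Fin k) ℤ →+* A)
    (μ : YoungDiagram) :
    f (schurPoly k μ) =
      tableauSum (fun i => if h : i < k then f (MvPolynomial.X ⟨i, h⟩) else 0) k μ := by
  unfold schurPoly tableauSum
  rw [map_sum]
  refine Finset.sum_congr rfl fun T _ => ?_
  rw [map_prod, ← Finset.prod_coe_sort μ.cells (fun c => if h : T.1 c.1 c.2 < k then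
    f (MvPolynomial.X ⟨T.1 c.1 c.2, h⟩) else 0)]
  refine Finset.prod_congr rfl fun c _ => ?_
  rw [dif_pos (T.2 c.1 c.2)]

theorem map_schurPoly_mul_alternant {A : Type*} [CommRing A] (f : MvPolynomial (Fin k) ℤ →+* A)
    {μ : YoungDiagram} (hμ : μ.colLen 0 ≤ k) :
    f (schurPoly k μ) * alternant (fun i => f (MvPolynomial.X i)) (stair k) =
      alternant (fun i => f (MvPolynomial.X i)) (fun i => μ.rowLen i + stair k i) := by
  have h := tableauSum_mul_det
    (fun i => if h : i < k then f (MvPolynomial.X ⟨i, h⟩) else 0) k μ hμ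
  rw [← map_schurPoly] at h
  have hrev : ∀ l : Fin k → ℕ, alternant (fun i => f (MvPolynomial.X i)) l =
      (Matrix.of fun i j : Fin k => (if h : ((j.rev : Fin k) : ℕ) < k then
        f (MvPolynomial.X ⟨j.rev, h⟩) else 0) ^ l i.rev).det := fun l => by
    unfold alternant
    rw [← Matrix.det_submatrix_equiv_self Fin.revPerm]
    congr 1
    ext i j
    rw [Matrix.submatrix_apply, Matrix.of_apply, Matrix.of_apply, dif_pos (Fin.is_lt _)]
    rfl
  rw [hrev, hrev]
  simpa [stair] using h

theorem schurPoly_mul_alternant {μ : YoungDiagram} (hμ : μ.colLen 0 ≤ k) :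
    schurPoly k μ * alternant MvPolynomial.X (stair k) =
      alternant (MvPolynomial.X : Fin k → MvPolynomial (Fin k) ℤ)
        (fun i => μ.rowLen i + stair k i) :=
  map_schurPoly_mul_alternant (RingHom.id _) hμ

/-- A permutation of the variables multiplies both alternants of the bialternant formula by the same
sign, and the Vandermonde factor can be cancelled. -/
theorem schurPoly_isSymmetric {μ : YoungDiagram} (hμ : μ.colLen 0 ≤ k) :
    (schurPoly k μ).IsSymmetric := by
  intro w
  have h := congrArg (MvPolynomial.rename w : MvPolynomial (Fin k) ℤ →ₐ[ℤ] _).toRingHom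
    (schurPoly_mul_alternant hμ)
  have hX : ((MvPolynomial.rename w : MvPolynomial (Fin k) ℤ →ₐ[ℤ] _).toRingHom ∘
      MvPolynomial.X : Fin k → MvPolynomial (Fin k) ℤ) = MvPolynomial.X ∘ w := by
    funext i
    simp
  rw [map_mul, map_alternant, map_alternant, hX, alternant_perm_comp, alternant_perm_comp,
    ← schurPoly_mul_alternant hμ] at h
  have h2 : _ * _ = _ * _ := congrArg (((Equiv.Perm.sign w : ℤ) : MvPolynomial (Fin k) ℤ) * ·) h
  rw [mul_left_comm, sign_mul_sign, sign_mul_sign] at h2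
  exact mul_right_cancel₀ (alternant_stair_ne_zero (MvPolynomial.X_injective)) h2

/-! ## The complete symmetric polynomials -/

theorem mk_pow_mul_one_sub {A : Type*} [CommRing A] (a : A) :
    PowerSeries.mk (fun r => a ^ r) * (1 - PowerSeries.C a * PowerSeries.X) = 1 := by
  ext r
  rw [mul_sub, mul_one, mul_left_comm, ← mul_assoc, map_sub]
  cases r with
  | zero => simp
  | succ r => simp [PowerSeries.coeff_succ_mul_X, pow_succ', PowerSeries.coeff_one]

theorem mk_hsymm {A : Type*} [CommRing A] (f : MvPolynomial (Fin k) ℤ →+* A) :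
    PowerSeries.mk (fun r => f (MvPolynomial.hsymm (Fin k) ℤ r)) =
      ∏ i, PowerSeries.mk (fun r => f (MvPolynomial.X i) ^ r) := by
  ext r
  rw [PowerSeries.coeff_mk, PowerSeries.coeff_prod, MvPolynomial.hsymm, map_sum]
  refine Finset.sum_bij' (fun s _ => Multiset.toFinsupp s.1)
    (fun l hl => ⟨Finsupp.toMultiset l, ?_⟩) ?_ ?_ ?_ ?_ ?_
  · rw [Finset.mem_finsuppAntidiag] at hl
    rw [Finsupp.card_toMultiset, ← hl.1, Finsupp.sum_fintype _ _ (fun _ => rfl)]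
    rfl
  · intro s _
    rw [Finset.mem_finsuppAntidiag]
    refine ⟨?_, Finset.subset_univ _⟩
    exact (Multiset.sum_count_eq_card (fun a _ => Finset.mem_univ a)).trans s.2
  · intro l _
    exact Finset.mem_univ _
  · intro s _
    exact Subtype.ext (by simp)
  · intro l _
    simp
  · intro s _
    rw [Finset.prod_multiset_map_count, map_prod]
    simp only [PowerSeries.coeff_mk, map_pow, Multiset.toFinsupp_apply]
    refine Finset.prod_subset (Finset.subset_univ _) fun i _ hi => ?_
    rw [Multiset.count_eq_zero.2 (by simpa using hi), pow_zero]

theorem mk_hsymm_mul_prod {A : Type*} [CommRing A] (f : MvPolynomial (Fin k) ℤ →+* A) :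
    PowerSeries.mk (fun r => f (MvPolynomial.hsymm (Fin k) ℤ r)) *
      ∏ i, (1 - PowerSeries.C (f (MvPolynomial.X i)) * PowerSeries.X) = 1 := by
  rw [mk_hsymm, ← Finset.prod_mul_distrib]
  exact Finset.prod_eq_one fun i _ => mk_pow_mul_one_sub _

/-- The polynomial `∏_{j ≠ i} (1 - x_j t)`. -/
def eraseProd {A : Type*} [CommRing A] (x : Fin k → A) (i : Fin k) : Polynomial A :=
  ∏ j ∈ Finset.univ.erase i, (1 - Polynomial.C (x j) * Polynomial.X)

theorem natDegree_one_sub_C_mul_X_le {A : Type*} [CommRing A] (a : A) :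
    (1 - Polynomial.C a * Polynomial.X).natDegree ≤ 1 := by
  refine (Polynomial.natDegree_sub_le _ _).trans ?_
  rw [Polynomial.natDegree_one, Nat.max_eq_right (Nat.zero_le _)]
  exact (Polynomial.natDegree_C_mul_le _ _).trans Polynomial.natDegree_X_le

theorem natDegree_eraseProd_le {A : Type*} [CommRing A] (x : Fin k → A) (i : Fin k) :
    (eraseProd x i).natDegree ≤ k - 1 := by
  refine (Polynomial.natDegree_prod_le _ _).trans ?_
  refine (Finset.sum_le_card_nsmul _ _ 1 fun j _ => natDegree_one_sub_C_mul_X_le _).trans ?_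
  simp

theorem coeff_eraseProd {A : Type*} [CommRing A] (x : Fin k → A) (i : Fin k) :
    (eraseProd x i).coeff (k - 1) = (-1) ^ (k - 1) * ∏ j ∈ Finset.univ.erase i, x j := by
  have h := Polynomial.coeff_prod_of_natDegree_le (s := Finset.univ.erase i)
    (fun j => 1 - Polynomial.C (x j) * Polynomial.X) 1
    (fun j _ => natDegree_one_sub_C_mul_X_le _)
  rw [mul_one, Finset.card_erase_of_mem (Finset.mem_univ i), Finset.card_univ,
    Fintype.card_fin] at h
  rw [eraseProd, h]
  simp [Polynomial.coeff_one, Finset.prod_neg]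

theorem mk_hsymm_mul_eraseProd {A : Type*} [CommRing A] (f : MvPolynomial (Fin k) ℤ →+* A)
    (i : Fin k) :
    PowerSeries.mk (fun r => f (MvPolynomial.hsymm (Fin k) ℤ r)) *
      (eraseProd (fun j => f (MvPolynomial.X j)) i : PowerSeries A) =
      PowerSeries.mk (fun r => f (MvPolynomial.X i) ^ r) := by
  have h := mk_hsymm_mul_prod f
  rw [← Finset.mul_prod_erase _ _ (Finset.mem_univ i)] at h
  have hc : (eraseProd (fun j => f (MvPolynomial.X j)) i : PowerSeries A) =
      ∏ j ∈ Finset.univ.erase i, (1 - PowerSeries.C (f (MvPolynomial.X j)) * PowerSeries.X) := by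
    rw [eraseProd, ← Polynomial.coeToPowerSeries.ringHom_apply, map_prod]
    refine Finset.prod_congr rfl fun j _ => ?_
    simp
  have h2 := mk_pow_mul_one_sub (f (MvPolynomial.X i))
  rw [hc]
  calc _ = (PowerSeries.mk (fun r => f (MvPolynomial.hsymm (Fin k) ℤ r)) *
      ∏ j ∈ Finset.univ.erase i, (1 - PowerSeries.C (f (MvPolynomial.X j)) * PowerSeries.X)) *
      (PowerSeries.mk (fun r => f (MvPolynomial.X i) ^ r) *
        (1 - PowerSeries.C (f (MvPolynomial.X i)) * PowerSeries.X)) := by rw [h2, mul_one]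
    _ = (PowerSeries.mk (fun r => f (MvPolynomial.hsymm (Fin k) ℤ r)) *
      ((1 - PowerSeries.C (f (MvPolynomial.X i)) * PowerSeries.X) *
        ∏ j ∈ Finset.univ.erase i, (1 - PowerSeries.C (f (MvPolynomial.X j)) * PowerSeries.X))) *
      PowerSeries.mk (fun r => f (MvPolynomial.X i) ^ r) := by ring
    _ = _ := by rw [h, one_mul]

/-- This is the coefficient of t^(d+k-1) in 1/(1 - x_i t) = H(t) ∏_{j≠i} (1 - x_j t), whose second
factor has degree at most k - 1. For d = n only h_n, …, h_{n+k-1} occur, and modulo the fusion ideal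
these are 1, 0, …, 0. -/
theorem X_pow_eq_sum (i : Fin k) (d : ℕ) :
    (MvPolynomial.X i : MvPolynomial (Fin k) ℤ) ^ (d + (k - 1)) =
      ∑ q ∈ Finset.range k, MvPolynomial.hsymm (Fin k) ℤ (d + (k - 1 - q)) *
        (eraseProd MvPolynomial.X i).coeff q := by
  have hk : 0 < k := i.pos
  have h := congrArg (PowerSeries.coeff (d + (k - 1))) (mk_hsymm_mul_eraseProd (RingHom.id _) i)
  rw [PowerSeries.coeff_mul, PowerSeries.coeff_mk] at h
  simp only [RingHom.id_apply, PowerSeries.coeff_mk, Polynomial.coeff_coe] at h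
  rw [← h, ← Finset.Nat.sum_antidiagonal_swap]
  simp only [Prod.fst_swap, Prod.snd_swap]
  rw [Finset.Nat.sum_antidiagonal_eq_sum_range_succ (fun q p =>
    MvPolynomial.hsymm (Fin k) ℤ p * (eraseProd MvPolynomial.X i).coeff q)]
  symm
  refine (Finset.sum_subset (s₁ := Finset.range k) (fun q hq => ?_) fun q _ hq => ?_).symm.trans
    (Finset.sum_congr rfl fun q hq => ?_) |>.symm
  · rw [Finset.mem_range] at *; omega
  · rw [Finset.mem_range] at hq
    rw [Polynomial.coeff_eq_zero_of_natDegree_lt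
      (lt_of_le_of_lt (natDegree_eraseProd_le _ _) (by omega)), mul_zero]
  · rw [Finset.mem_range] at hq
    congr 2
    omega

/-! ## Weights and their columns -/

theorem Weight.lt_colLen_iff (a : Weight n k) (i j : ℕ) :
    i < a.diagram.colLen j ↔ j < a.part i := by
  rw [← YoungDiagram.mem_iff_lt_colLen, a.mem_diagram]

theorem Weight.colLen_lt [NeZero n] (a : Weight n k) (j : ℕ) : a.diagram.colLen j < n := by
  have hn := NeZero.pos n
  by_contra h
  have := (a.lt_colLen_iff (n - 1) j).1 (by omega)
  rw [a.part_eq_zero (by omega)] at this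
  omega

theorem Weight.colLen_transpose_le (a : Weight n k) : a.diagram.transpose.colLen 0 ≤ k := by
  rw [YoungDiagram.colLen_transpose]
  by_contra h
  have := (a.mem_diagram 0 k).1 (YoungDiagram.mem_iff_lt_rowLen.2 (not_le.1 h))
  exact absurd (a.part_le 0) (not_le.2 this)

/-- The weight whose diagram has columns of the given lengths. -/
def weightOfColumns (s : Fin k → ℕ) (hs : ∀ j, s j < n) : Weight n k :=
  ⟨fun i => (Finset.univ.filter fun j => s j = i).card, by
    have h := Finset.card_eq_sum_card_fiberwise (f := fun j => (⟨s j, hs j⟩ : Fin n))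
      (s := Finset.univ) (t := Finset.univ) (fun _ _ => Finset.mem_coe.2 (Finset.mem_univ _))
    rw [Finset.card_univ, Fintype.card_fin] at h
    refine (Finset.sum_congr rfl fun i _ => congrArg Finset.card ?_).trans h.symm
    ext j
    simp [Fin.ext_iff]⟩

theorem part_weightOfColumns (s : Fin k → ℕ) (hs : ∀ j, s j < n) (i : ℕ) :
    (weightOfColumns s hs).part i = (Finset.univ.filter fun j => i < s j).card := by
  unfold Weight.part weightOfColumns
  have h := Finset.card_eq_sum_card_fiberwise (f := fun j => (⟨s j, hs j⟩ : Fin n))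
      (s := Finset.univ.filter fun j => i < s j)
      (t := Finset.univ.filter (fun j : Fin n => i < (j : ℕ))) (fun j hj => by
        simpa using hj)
  rw [h]
  refine Finset.sum_congr rfl fun l hl => ?_
  dsimp only
  refine congrArg Finset.card ?_
  ext j
  simp only [Finset.mem_filter, Finset.mem_univ, true_and, Fin.ext_iff] at hl ⊢
  omega

theorem colLen_weightOfColumns {s : Fin k → ℕ} (hs : ∀ j, s j < n) (ha : Antitone s) (j : Fin k) :
    (weightOfColumns s hs).diagram.colLen j = s j := by
  refine eq_of_forall_lt_iff fun i => ?_
  rw [Weight.lt_colLen_iff, part_weightOfColumns]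
  exact Tuple.lt_card_gt_iff_apply_gt_of_antitone ha

/-- The Schur polynomial attached to a weight, as a symmetric polynomial. -/
def Weight.schur (a : Weight n k) : SymPoly k :=
  ⟨schurPoly k a.diagram.transpose, schurPoly_isSymmetric a.colLen_transpose_le⟩

/-! ## Alternating sums -/

/-- Antisymmetrization. -/
def altSum (k : ℕ) : MvPolynomial (Fin k) ℤ →ₗ[ℤ] MvPolynomial (Fin k) ℤ :=
  ∑ w : Equiv.Perm (Fin k), (Equiv.Perm.sign w : ℤ) • (MvPolynomial.rename w).toLinearMap

theorem altSum_apply (f : MvPolynomial (Fin k) ℤ) :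
    altSum k f = ∑ w : Equiv.Perm (Fin k), (Equiv.Perm.sign w : ℤ) • MvPolynomial.rename w f := by
  simp [altSum]

theorem altSum_mul {g : MvPolynomial (Fin k) ℤ} (hg : g.IsSymmetric)
    (f : MvPolynomial (Fin k) ℤ) : altSum k (g * f) = g * altSum k f := by
  rw [altSum_apply, altSum_apply, Finset.mul_sum]
  refine Finset.sum_congr rfl fun w _ => ?_
  rw [map_mul, hg w, mul_smul_comm]

/-- The monomial `∏ x_i ^ l_i`. -/
def monom (l : Fin k → ℕ) : MvPolynomial (Fin k) ℤ := ∏ i, MvPolynomial.X i ^ l i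

theorem altSum_monom (l : Fin k → ℕ) : altSum k (monom l) = alternant MvPolynomial.X l := by
  rw [altSum_apply, alternant, ← Matrix.det_transpose, Matrix.det_apply]
  refine Finset.sum_congr rfl fun w _ => ?_
  simp [monom, Units.smul_def]

theorem exists_strictAnti_comp {l : Fin k → ℕ} (hl : Function.Injective l) :
    ∃ w : Equiv.Perm (Fin k), StrictAnti (l ∘ w) := by
  refine ⟨Fin.revPerm.trans (Tuple.sort l), ?_⟩
  have h1 : StrictMono (l ∘ Tuple.sort l) :=
    (Tuple.monotone_sort l).strictMono_of_injective (hl.comp (Tuple.sort l).injective)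
  exact fun i j hij => h1 (Fin.rev_lt_rev.2 hij)

theorem stair_le_of_strictAnti {m : Fin k → ℕ} (hm : StrictAnti m) :
    (∀ i, stair k i ≤ m i) ∧ Antitone fun i => m i - stair k i := by
  have key : ∀ i j : Fin k, i ≤ j → m j + ((j : ℕ) - i) ≤ m i := by
    intro i j hij
    obtain ⟨d, hd⟩ := Nat.exists_eq_add_of_le (Fin.le_def.1 hij)
    induction d generalizing j with
    | zero =>
      have : i = j := Fin.ext (by omega)
      subst this; simp
    | succ d ih =>
      have h1 := ih ⟨i + d, by omega⟩ (Fin.le_def.2 (by simp)) rfl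
      have h2 : m j < m ⟨i + d, by omega⟩ := hm (Fin.lt_def.2 (by simp only; omega))
      simp only at h1
      omega
  constructor
  · intro i
    have hi := i.2
    have := key i ⟨k - 1, by omega⟩ (Fin.le_def.2 (by simp only; omega))
    simp only at this
    simp only [stair, Fin.val_rev]
    omega
  · intro i j hij
    have := key i j hij
    have h3 := Fin.le_def.1 hij
    simp only [stair, Fin.val_rev]
    omega

/-- Sorting the exponents costs a sign; subtracting the staircase from the sorted exponents leaves a
partition, whose Schur polynomial is the quotient. Repeated exponents give 0. -/
theorem exists_mul_eq_alternant (l : Fin k → ℕ) :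
    ∃ g : SymPoly k, (g : MvPolynomial (Fin k) ℤ) * alternant MvPolynomial.X (stair k) =
      alternant MvPolynomial.X l := by
  by_cases hl : Function.Injective l
  · obtain ⟨w, hw⟩ := exists_strictAnti_comp hl
    obtain ⟨h1, h2⟩ := stair_le_of_strictAnti hw
    refine ⟨(Equiv.Perm.sign w : ℤ) • ⟨schurPoly k (ofRowFun fun i => (l ∘ w) i - stair k i),
      schurPoly_isSymmetric (colLen_ofRowFun_le h2)⟩, ?_⟩
    have h3 := schurPoly_mul_alternant (k := k) (colLen_ofRowFun_le h2)
    simp only [rowLen_ofRowFun h2, Nat.sub_add_cancel (h1 _)] at h3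
    change ((Equiv.Perm.sign w : ℤ) • schurPoly k _) * _ = _
    rw [smul_mul_assoc, h3, zsmul_eq_mul]
    change _ * alternant _ (l ∘ w) = _
    rw [alternant_comp_perm, sign_mul_sign]
  · exact ⟨0, by rw [alternant_eq_zero _ hl]; simp⟩

/-! ## The Schur polynomials of weights span the quotient -/

/-- The symmetric polynomials that modulo the fusion ideal are combinations of the Schur polynomials
of weights. -/
def schurSpan (n k : ℕ) : Submodule ℤ (SymPoly k) :=
  Submodule.span ℤ (Set.range (Weight.schur : Weight n k → SymPoly k)) ⊔
    (fusionIdeal n k).restrictScalars ℤ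

/-- The polynomials whose alternating sum is the product of the Vandermonde determinant and an
element of the given group of symmetric polynomials. -/
def altComap (W : Submodule ℤ (SymPoly k)) : Submodule ℤ (MvPolynomial (Fin k) ℤ) :=
  (W.map ((LinearMap.mulRight ℤ (alternant MvPolynomial.X (stair k))).comp
    (MvPolynomial.symmetricSubalgebra (Fin k) ℤ).val.toLinearMap)).comap (altSum k)

theorem mem_altComap {W : Submodule ℤ (SymPoly k)} {f : MvPolynomial (Fin k) ℤ} :
    f ∈ altComap W ↔ ∃ g ∈ W, (g : MvPolynomial (Fin k) ℤ) *
      alternant MvPolynomial.X (stair k) = altSum k f := by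
  simp [altComap]

theorem altComap_eq_top {W : Submodule ℤ (SymPoly k)} (h : ∀ l, monom l ∈ altComap W) :
    altComap W = ⊤ := by
  refine eq_top_iff.2 fun f _ => ?_
  induction f using MvPolynomial.induction_on' with
  | monomial u a =>
    rw [MvPolynomial.monomial_eq, Finsupp.prod_fintype _ _ (fun _ => pow_zero _),
      MvPolynomial.C_eq_smul_one, smul_mul_assoc, one_mul]
    exact Submodule.smul_mem _ _ (h u)
  | add p q hp hq => exact Submodule.add_mem _ (hp trivial) (hq trivial)

theorem exists_mul_eq_altSum (f : MvPolynomial (Fin k) ℤ) :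
    ∃ g : SymPoly k, (g : MvPolynomial (Fin k) ℤ) * alternant MvPolynomial.X (stair k) =
      altSum k f := by
  have h : altComap (⊤ : Submodule ℤ (SymPoly k)) = ⊤ := altComap_eq_top fun l => by
    obtain ⟨g, hg⟩ := exists_mul_eq_alternant l
    exact mem_altComap.2 ⟨g, trivial, by rw [hg, altSum_monom]⟩
  obtain ⟨g, _, hg⟩ := mem_altComap.1 (h.symm ▸ Submodule.mem_top : f ∈ altComap ⊤)
  exact ⟨g, hg⟩

/-- Antisymmetrization is linear over symmetric polynomials, so an ideal element passes through it
and multiplies the symmetric quotient. -/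
theorem mul_mem_altComap {g : SymPoly k} (hg : g ∈ fusionIdeal n k) (f : MvPolynomial (Fin k) ℤ) :
    (g : MvPolynomial (Fin k) ℤ) * f ∈ altComap (schurSpan n k) := by
  obtain ⟨g', hg'⟩ := exists_mul_eq_altSum f
  refine mem_altComap.2 ⟨g * g', ?_, ?_⟩
  · exact Submodule.mem_sup_right (Ideal.mul_mem_right _ _ hg)
  · rw [altSum_mul g.2, ← hg', ← mul_assoc]
    rfl

/-- The largest sorted exponent is at most n + k - 2, so after removal of the staircase every part
is at most n - 1. The parts are then the column lengths of the diagram of a weight. -/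
theorem monom_mem_of_lt {l : Fin k → ℕ} (hl : ∀ i, l i < n + (k - 1)) :
    monom l ∈ altComap (schurSpan n k) := by
  rw [mem_altComap, altSum_monom]
  by_cases hinj : Function.Injective l
  · obtain ⟨w, hw⟩ := exists_strictAnti_comp hinj
    obtain ⟨h1, h2⟩ := stair_le_of_strictAnti hw
    have hlt : ∀ j : Fin k, (l ∘ w) j - stair k j < n := fun j => by
      have h0 := h2 (show (⟨0, j.pos⟩ : Fin k) ≤ j from Fin.le_def.2 (Nat.zero_le _))
      have h3 := hl (w ⟨0, j.pos⟩)
      have h4 := h1 ⟨0, j.pos⟩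
      simp only [stair, Fin.val_rev, Function.comp_apply] at h0 h3 h4 ⊢
      omega
    refine ⟨(Equiv.Perm.sign w : ℤ) • (weightOfColumns _ hlt).schur, ?_, ?_⟩
    · exact Submodule.smul_mem _ _ (Submodule.mem_sup_left (Submodule.subset_span ⟨_, rfl⟩))
    · have h3 := schurPoly_mul_alternant (weightOfColumns _ hlt).colLen_transpose_le
      simp only [YoungDiagram.rowLen_transpose, colLen_weightOfColumns hlt h2,
        Nat.sub_add_cancel (h1 _)] at h3
      change ((Equiv.Perm.sign w : ℤ) • schurPoly k _) * _ = _
      rw [smul_mul_assoc, h3, zsmul_eq_mul]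
      change _ * alternant _ (l ∘ w) = _
      rw [alternant_comp_perm, sign_mul_sign]
  · exact ⟨0, Submodule.zero_mem _, by rw [alternant_eq_zero _ hinj]; simp⟩

/-- Induction on the total degree. An exponent of at least n + k - 1 is lowered by `X_pow_eq_sum`
with d = n: modulo the ideal only the term with h_n survives, with h_n replaced by 1. The last
generator of the ideal plays no part here. -/
theorem monom_mem [NeZero n] (l : Fin k → ℕ) : monom l ∈ altComap (schurSpan n k) := by
  induction hs : ∑ i, l i using Nat.strong_induction_on generalizing l with
  | _ S ih =>
  by_cases hl : ∀ i, l i < n + (k - 1)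
  · exact monom_mem_of_lt hl
  obtain ⟨i, hi⟩ := not_forall.1 hl
  have hk := i.pos
  have hn := NeZero.pos n
  set r := ∏ j ∈ Finset.univ.erase i,
    (MvPolynomial.X j : MvPolynomial (Fin k) ℤ) ^ l j with hr
  set m := (MvPolynomial.X i : MvPolynomial (Fin k) ℤ) ^ (l i - (n + (k - 1))) * r with hm
  have hmon : monom l = MvPolynomial.X i ^ (n + (k - 1)) * m := by
    rw [monom, ← Finset.mul_prod_erase _ _ (Finset.mem_univ i), hm, ← mul_assoc, ← pow_add,
      Nat.add_sub_cancel' (not_lt.1 hi)]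
  rw [hmon, X_pow_eq_sum, Finset.sum_mul]
  refine Submodule.sum_mem _ fun q hq => ?_
  rw [Finset.mem_range] at hq
  rw [mul_assoc]
  by_cases hq' : q = k - 1
  · subst hq'
    rw [Nat.sub_self, add_zero, show MvPolynomial.hsymm (Fin k) ℤ n *
      ((eraseProd MvPolynomial.X i).coeff (k - 1) * m) =
        ((h k n - 1 : SymPoly k) : MvPolynomial (Fin k) ℤ) *
          ((eraseProd MvPolynomial.X i).coeff (k - 1) * m) +
          (eraseProd MvPolynomial.X i).coeff (k - 1) * m from ?_]
    · refine Submodule.add_mem _ (mul_mem_altComap (Ideal.subset_span (Or.inl (Or.inl rfl))) _) ?_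
      -- The surviving coefficient is ± the product of the other variables. The degree drops by n +
      -- k - 1 and rises by k - 1, a net loss of n > 0.
      set l' : Fin k → ℕ := fun j => if j = i then l i - (n + (k - 1)) else l j + 1 with hl'
      have h2 : (eraseProd MvPolynomial.X i).coeff (k - 1) * m =
          ((-1) ^ (k - 1) : ℤ) • monom l' := by
        rw [coeff_eraseProd, hm, hr, monom, ← Finset.mul_prod_erase _ _ (Finset.mem_univ i)]
        have : ∏ j ∈ Finset.univ.erase i, (MvPolynomial.X j : MvPolynomial (Fin k) ℤ) ^ l' j =
            (∏ j ∈ Finset.univ.erase i, MvPolynomial.X j) *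
              ∏ j ∈ Finset.univ.erase i, MvPolynomial.X j ^ l j := by
          rw [← Finset.prod_mul_distrib]
          refine Finset.prod_congr rfl fun j hj => ?_
          rw [hl']
          simp only [if_neg (Finset.ne_of_mem_erase hj), pow_succ']
        rw [this, hl', zsmul_eq_mul]
        simp only [if_true]
        push_cast
        ring
      rw [h2]
      refine Submodule.smul_mem _ _ (ih (∑ j, l' j) ?_ l' rfl)
      rw [← hs, ← Finset.add_sum_erase _ _ (Finset.mem_univ i),
        ← Finset.add_sum_erase _ l (Finset.mem_univ i)]
      have : ∑ j ∈ Finset.univ.erase i, l' j = ∑ j ∈ Finset.univ.erase i, l j + (k - 1) := by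
        rw [Finset.sum_congr rfl (g := fun j => l j + 1), Finset.sum_add_distrib]
        · simp [Finset.card_erase_of_mem]
        · intro j hj
          rw [hl']
          simp only [if_neg (Finset.ne_of_mem_erase hj)]
      rw [this, hl']
      simp only [if_true]
      omega
    · change _ = (MvPolynomial.hsymm (Fin k) ℤ n - 1) * _ + _
      ring
  · exact mul_mem_altComap (g := h k (n + (k - 1 - q)))
      (Ideal.subset_span (Or.inl (Or.inr ⟨_, by omega, by omega, rfl⟩))) _

/-- For symmetric f, the antisymmetrization of f x^δ is f times the Vandermonde determinant, so the
result on monomials yields f itself after cancellation. -/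
theorem schurSpan_eq_top [NeZero n] : schurSpan n k = ⊤ := by
  refine eq_top_iff.2 fun f _ => ?_
  have h := altComap_eq_top (monom_mem (n := n) (k := k))
  obtain ⟨g, hg, he⟩ := mem_altComap.1
    (h.symm ▸ Submodule.mem_top : (f : MvPolynomial (Fin k) ℤ) * monom (stair k) ∈ _)
  rw [altSum_mul f.2, altSum_monom] at he
  have := mul_right_cancel₀ (alternant_stair_ne_zero MvPolynomial.X_injective) he
  rwa [← Subtype.ext this]

theorem exists_sub_mem_fusionIdeal [NeZero n] (f : SymPoly k) :
    ∃ c : Weight n k → ℤ, f - ∑ a, c a • a.schur ∈ fusionIdeal n k := by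
  have hf : f ∈ schurSpan n k := schurSpan_eq_top (n := n) ▸ Submodule.mem_top
  obtain ⟨g, hg, i, hi, rfl⟩ := Submodule.mem_sup.1 hf
  obtain ⟨c, rfl⟩ := (Submodule.mem_span_range_iff_exists_fun ℤ).1 hg
  exact ⟨c, by simpa using hi⟩

/-! ## The exponents of a weight -/

/-- The exponents `λ_l + n - l` of a weight, which are the coordinates of `λ + ρ` up to a shift. -/
def Weight.expo (a : Weight n k) (l : Fin n) : ℕ := a.part l + stair n l

theorem Weight.expo_strictAnti (a : Weight n k) : StrictAnti a.expo := fun i j hij => by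
  have h1 := a.part_anti (Fin.lt_def.1 hij).le
  have h2 := Fin.lt_def.1 hij
  simp only [Weight.expo, stair, Fin.val_rev]
  omega

theorem Weight.expo_lt (a : Weight n k) (l : Fin n) : a.expo l < n + k := by
  have h1 := a.part_le l
  simp only [Weight.expo, stair, Fin.val_rev]
  omega

theorem Weight.expo_of_eq (a : Weight n k) {l : Fin n} (hl : (l : ℕ) + 1 = n) : a.expo l = 0 := by
  simp only [Weight.expo, stair, Fin.val_rev, a.part_eq_zero hl.ge]
  omega

theorem Weight.part_eq_sum (a : Weight n k) (i : ℕ) :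
    a.part i = ∑ j : Fin n, if i < (j : ℕ) then a.1 j else 0 := Finset.sum_filter _ _

/-- Removing the staircase leaves a partition with parts at most k and last part 0. The weight is
built from the column lengths of this partition, and counting columns recovers its rows. -/
theorem exists_weight_expo_eq {J : Fin n → ℕ} (hJ : StrictAnti J) (hlt : ∀ l, J l < n + k)
    (h0 : ∃ l, J l = 0) : ∃ a : Weight n k, a.expo = J := by
  obtain ⟨h1, h2⟩ := stair_le_of_strictAnti hJ
  obtain ⟨l₀, hl₀⟩ := h0
  have hs : ∀ j : Fin k,
      (Finset.univ.filter fun l : Fin n => (j : ℕ) < J l - stair n l).card < n := fun j => by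
    refine (Finset.card_lt_card (Finset.filter_ssubset.2 ⟨l₀, Finset.mem_univ _, ?_⟩)).trans_eq
      (by simp)
    omega
  refine ⟨weightOfColumns _ hs, funext fun l => ?_⟩
  unfold Weight.expo
  rw [part_weightOfColumns]
  have hle : J l - stair n l ≤ k := by
    have h3 := h2 (show (⟨0, l.pos⟩ : Fin n) ≤ l from Fin.le_def.2 (Nat.zero_le _))
    have h4 := hlt ⟨0, l.pos⟩
    simp only [stair, Fin.val_rev] at h3 ⊢
    omega
  have : (Finset.univ.filter fun j : Fin k => (l : ℕ) <
      (Finset.univ.filter fun l : Fin n => (j : ℕ) < J l - stair n l).card) =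
      Finset.univ.filter fun j : Fin k => (j : ℕ) < J l - stair n l := by
    ext j
    simp only [Finset.mem_filter, Finset.mem_univ, true_and]
    exact Tuple.lt_card_gt_iff_apply_gt_of_antitone h2
  rw [this, Fin.card_filter_val_lt, Nat.min_eq_right hle, Nat.sub_add_cancel (h1 l)]

theorem strictAnti_eq_of_comp_eq {J J' : Fin n → ℕ} (hJ : StrictAnti J) (hJ' : StrictAnti J')
    {w w' : Equiv.Perm (Fin n)} (h : J ∘ w = J' ∘ w') : J = J' ∧ w = w' := by
  have hr : Set.range J = Set.range J' := by
    rw [← w.surjective.range_comp J, h, w'.surjective.range_comp]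
  have : J = J' := by
    have h1 : StrictMono (J ∘ Fin.rev) := fun i j hij => hJ (Fin.rev_lt_rev.2 hij)
    have h2 : StrictMono (J' ∘ Fin.rev) := fun i j hij => hJ' (Fin.rev_lt_rev.2 hij)
    have := (StrictMono.range_inj h1 h2).1 (by
      rw [Fin.rev_surjective.range_comp, Fin.rev_surjective.range_comp, hr])
    funext i
    simpa using congrFun this i.rev
  subst this
  exact ⟨rfl, Equiv.ext fun i => hJ.injective (congrFun h i)⟩

theorem expo_injective : Function.Injective (Weight.expo : Weight n k → Fin n → ℕ) := by
  intro a b hab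
  have hp : ∀ i, a.part i = b.part i := fun i => by
    by_cases hi : i < n
    · have := congrFun hab ⟨i, hi⟩
      simpa [Weight.expo] using this
    · rw [a.part_eq_zero (by omega), b.part_eq_zero (by omega)]
  have hlab : ∀ (c : Weight n k) (i : Fin n), 0 < (i : ℕ) →
      c.part (i - 1) = c.1 i + c.part i := fun c i hi => by
    rw [c.part_eq_sum, c.part_eq_sum, ← Finset.add_sum_erase _ _ (Finset.mem_univ i),
      ← Finset.add_sum_erase (a := i) _ (fun j : Fin n => if (i : ℕ) < (j : ℕ) then c.1 j else 0)
        (Finset.mem_univ i), if_pos (by omega), if_neg (lt_irrefl _), zero_add]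
    congr 1
    refine Finset.sum_congr rfl fun j hj => ?_
    have := Finset.ne_of_mem_erase hj
    have : (j : ℕ) ≠ i := fun h => this (Fin.ext h)
    congr 1
    simp only [eq_iff_iff]
    omega
  have hpos : ∀ i : Fin n, 0 < (i : ℕ) → a.1 i = b.1 i := fun i hi => by
    have h1 := hlab a i hi
    have h2 := hlab b i hi
    rw [hp, hp] at h1
    omega
  refine Subtype.ext (funext fun i => ?_)
  by_cases hi : 0 < (i : ℕ)
  · exact hpos i hi
  · have h1 := a.2
    have h2 := b.2
    rw [← Finset.add_sum_erase _ _ (Finset.mem_univ i)] at h1 h2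
    rw [Finset.sum_congr rfl (g := fun j => b.1 j) fun j hj => hpos j ?_] at h1
    · omega
    · have := Finset.ne_of_mem_erase hj
      have : (j : ℕ) ≠ i := fun h => this (Fin.ext h)
      omega

/-- The rotation `m_i ↦ m_{i+1}` of the Dynkin labels. -/
def rotate (n k : ℕ) : Weight n k ≃ Weight n k :=
  (Equiv.arrowCongr (finRotate n).symm (Equiv.refl ℕ)).subtypeEquiv fun m => by
    have : ∑ i, ((finRotate n).symm.arrowCongr (Equiv.refl ℕ)) m i = ∑ i, m i :=
      Equiv.sum_comp (finRotate n) m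
    rw [this]

theorem rotate_apply (a : Weight n k) (i : Fin n) : (rotate n k a).1 i = a.1 (finRotate n i) := rfl

/-- Rotating the labels shifts the exponents cyclically and adds a constant, m_0 + 1. The former
largest exponent would become k + n and wraps around to 0. -/
theorem expo_rotate (a : Weight n k) : ∃ c : ℝ, ∀ l,
    ((rotate n k a).expo l : ℝ) =
      a.expo (finRotate n l) + c - if (l : ℕ) + 1 = n then ((k : ℝ) + n) else 0 := by
  cases n with
  | zero => exact ⟨0, fun l => l.elim0⟩
  | succ n =>
  refine ⟨a.1 0 + 1, fun l => ?_⟩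
  have hsum : a.part 0 + a.1 0 = k := by
    have h := a.2
    rw [Fin.sum_univ_succ] at h
    rw [a.part_eq_sum, Fin.sum_univ_succ]
    simp only [Fin.val_zero, lt_irrefl, if_false, Fin.val_succ, Nat.succ_pos, if_true]
    omega
  induction l using Fin.lastCases with
  | last =>
    rw [(rotate _ k a).expo_of_eq (by simp), finRotate_last]
    have : (a.expo 0 : ℝ) + (a.1 0 + 1) = k + (n + 1 : ℕ) := by
      have h2 : a.expo 0 + (a.1 0 + 1) = k + (n + 1) := by
        simp only [Weight.expo, stair, Fin.val_rev, Fin.val_zero]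
        omega
      exact_mod_cast h2
    simp [this]
  | cast l =>
    have h1 : finRotate (n + 1) l.castSucc = l.succ := by
      rw [finRotate_apply, Fin.coeSucc_eq_succ]
    have h2 : (rotate _ k a).part l = a.part (l + 1) + a.1 0 := by
      rw [Weight.part_eq_sum, Fin.sum_univ_castSucc, Weight.part_eq_sum, Fin.sum_univ_succ]
      simp [rotate_apply]
    have h3 : (rotate _ k a).expo l.castSucc = a.expo l.succ + (a.1 0 + 1) := by
      simp only [Weight.expo, stair, Fin.val_rev, Fin.val_castSucc, Fin.val_succ, h2]
      omega
    rw [h1, h3, if_neg (by simp only [Fin.val_castSucc]; omega)]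
    push_cast
    ring

/-- The diagram of the conjugate weight is the complement, turned by 180°, of the diagram in the
rectangle with n rows of length λ_1. -/
theorem expo_conj [NeZero n] (a : Weight n k) (l : Fin n) :
    a.conj.expo l + a.expo l.rev = a.expo 0 := by
  cases n with
  | zero => exact l.elim0
  | succ n =>
  have h1 : a.conj.part l + a.part l.rev = a.part 0 := by
    rw [Weight.part_eq_sum, Weight.part_eq_sum, Weight.part_eq_sum, Fin.sum_univ_succ,
      Fin.sum_univ_succ, Fin.sum_univ_succ]
    simp only [Fin.val_zero, Nat.not_lt_zero, if_false, zero_add, Fin.val_succ, Nat.succ_pos,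
      if_true]
    rw [← Equiv.sum_comp Fin.revPerm, ← Finset.sum_add_distrib]
    refine Finset.sum_congr rfl fun j _ => ?_
    have hneg : -(Fin.succ (Fin.rev j)) = j.succ := by
      rw [neg_eq_iff_add_eq_zero]
      ext
      simp only [Fin.val_add, Fin.val_succ, Fin.val_rev, Fin.val_zero]
      rw [show n - (j + 1) + 1 + (j + 1) = n + 1 by omega, Nat.mod_self]
    have hl := l.2
    simp only [Weight.conj, Fin.revPerm_apply, hneg, Fin.val_rev]
    split_ifs <;> omega
  have hl := l.2
  simp only [Weight.expo, stair, Fin.val_rev, Fin.val_zero] at h1 ⊢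
  omega

/-! ## Determinants of characters of `ℤ/N` -/

/-- The determinant `det (χ (p_j u_i))` for the standard additive character `χ` of `ℤ/N`. -/
def charDet {N : ℕ} [NeZero N] (p u : Fin n → ZMod N) : ℂ :=
  (Matrix.of fun i j => ZMod.stdAddChar (p j * u i)).det

section charDet
variable {N : ℕ} [NeZero N]

theorem stdAddChar_sum {ι : Type*} (s : Finset ι) (f : ι → ZMod N) :
    (ZMod.stdAddChar (∑ i ∈ s, f i) : ℂ) = ∏ i ∈ s, ZMod.stdAddChar (f i) := by
  classical
  induction s using Finset.induction_on with
  | empty => simp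
  | insert a s ha ih => rw [Finset.sum_insert ha, Finset.prod_insert ha, AddChar.map_add_eq_mul, ih]

theorem charDet_comp_perm (p u : Fin n → ZMod N) (w : Equiv.Perm (Fin n)) :
    charDet (p ∘ w) u = ((Equiv.Perm.sign w : ℤ) : ℂ) * charDet p u :=
  Matrix.det_permute' w (Matrix.of fun i j => ZMod.stdAddChar (p j * u i))

theorem charDet_eq_zero {p : Fin n → ZMod N} (hp : ¬ Function.Injective p) (u : Fin n → ZMod N) :
    charDet p u = 0 := by
  simp only [Function.Injective, not_forall] at hp
  obtain ⟨i, j, h, hij⟩ := hp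
  exact Matrix.det_zero_of_column_eq hij fun m => by simp [h]

theorem charDet_add_const_left (p u : Fin n → ZMod N) (c : ZMod N) :
    charDet (fun j => p j + c) u = ZMod.stdAddChar (c * ∑ i, u i) * charDet p u := by
  unfold charDet
  have h := Matrix.det_mul_column (fun i => ZMod.stdAddChar (c * u i))
    (Matrix.of fun i j => ZMod.stdAddChar (p j * u i))
  rw [Finset.mul_sum, stdAddChar_sum, ← h]
  congr 1
  ext i j
  simp only [Matrix.of_apply]
  rw [← AddChar.map_add_eq_mul]
  ring_nf

theorem charDet_add_const_right (p u : Fin n → ZMod N) (c : ZMod N) :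
    charDet p (fun i => u i + c) = ZMod.stdAddChar (c * ∑ j, p j) * charDet p u := by
  unfold charDet
  have h := Matrix.det_mul_row (fun j => ZMod.stdAddChar (c * p j))
    (Matrix.of fun i j => ZMod.stdAddChar (p j * u i))
  rw [Finset.mul_sum, stdAddChar_sum, ← h]
  congr 1
  ext i j
  simp only [Matrix.of_apply]
  rw [← AddChar.map_add_eq_mul]
  ring_nf

theorem charDet_eq_sum (p u : Fin n → ZMod N) :
    charDet p u = ∑ w : Equiv.Perm (Fin n), ((Equiv.Perm.sign w : ℤ) : ℂ) *
      ∏ j, ZMod.stdAddChar (p j * u (w j)) := by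
  rw [charDet, Matrix.det_apply']
  rfl

/-- After expansion of both determinants the sum over tuples factors over the coordinates, and each
factor is a complete character sum over ℤ/N. -/
theorem sum_charDet_mul_charDet (u v : Fin n → ZMod N) :
    ∑ p : Fin n → ZMod N, charDet p u * charDet p v =
      ∑ w : Equiv.Perm (Fin n), ∑ w' : Equiv.Perm (Fin n),
        ((Equiv.Perm.sign w : ℤ) : ℂ) * ((Equiv.Perm.sign w' : ℤ) : ℂ) *
          ∏ j, if u (w j) + v (w' j) = 0 then (N : ℂ) else 0 := by
  simp only [charDet_eq_sum, Finset.sum_mul_sum]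
  rw [Finset.sum_comm]
  refine Finset.sum_congr rfl fun w _ => ?_
  rw [Finset.sum_comm]
  refine Finset.sum_congr rfl fun w' _ => ?_
  have h : ∀ j, (if u (w j) + v (w' j) = 0 then (N : ℂ) else 0) =
      ∑ x : ZMod N, ZMod.stdAddChar (x * (u (w j) + v (w' j))) := fun j => by
    rw [AddChar.sum_mulShift _ (ZMod.isPrimitive_stdAddChar N), ZMod.card]
    push_cast
    rfl
  simp only [h]
  rw [Finset.prod_univ_sum, Fintype.piFinset_univ, Finset.mul_sum]
  refine Finset.sum_congr rfl fun p _ => ?_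
  rw [mul_mul_mul_comm, ← Finset.prod_mul_distrib]
  congr 1
  refine Finset.prod_congr rfl fun j _ => ?_
  rw [← AddChar.map_add_eq_mul, mul_add]

end charDet

/-! ## Sums over weights as sums over tuples -/

/-- The exponents of a weight modulo `n + k`. -/
def Weight.residues (a : Weight n k) (l : Fin n) : ZMod (n + k) := a.expo l

theorem cast_inj_of_lt {N x y : ℕ} (hx : x < N) (hy : y < N) :
    (x : ZMod N) = (y : ZMod N) ↔ x = y := by
  rw [ZMod.natCast_eq_natCast_iff', Nat.mod_eq_of_lt hx, Nat.mod_eq_of_lt hy]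

/-- By shift invariance, fixing one coordinate to be 0 costs a factor n + k. Summing over which
coordinate is fixed counts every injective tuple that takes the value 0 exactly once, and such a
tuple is uniquely a permutation of the residues of a weight. This replaces sums over weights by free
sums over tuples. -/
theorem sum_tuples_eq [NeZero n] {F : (Fin n → ZMod (n + k)) → ℂ}
    (hinj : ∀ p, ¬ Function.Injective p → F p = 0)
    (hperm : ∀ p (w : Equiv.Perm (Fin n)), F (p ∘ w) = F p)
    (hshift : ∀ p c, F (fun j => p j + c) = F p) :
    (n : ℂ) * ∑ p, F p = ((n + k : ℕ) : ℂ) * (n.factorial * ∑ a : Weight n k, F a.residues) := by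
  classical
  have hn := NeZero.pos n
  have h1 : ∀ j : Fin n, ∑ p, F p = ((n + k : ℕ) : ℂ) * ∑ p, if p j = 0 then F p else 0 := by
    intro j
    have : ∑ p, F p = ∑ p, ∑ c, if p j = c then F p else 0 := by simp
    rw [this, Finset.sum_comm]
    have h2 : ∀ c : ZMod (n + k), (∑ p : Fin n → ZMod (n + k), if p j = c then F p else 0) =
        ∑ p, if p j = 0 then F p else 0 := fun c => by
      rw [← Equiv.sum_comp (Equiv.addRight fun _ : Fin n => c)]
      refine Finset.sum_congr rfl fun p _ => ?_
      have : F (p + fun _ => c) = F p := hshift p c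
      simp [this]
    simp [h2, ZMod.card]
  have h3 : (n : ℂ) * ∑ p, F p =
      ((n + k : ℕ) : ℂ) * ∑ p, ∑ j : Fin n, if p j = 0 then F p else 0 := by
    calc (n : ℂ) * ∑ p, F p = ∑ _j : Fin n, ∑ p, F p := by simp
      _ = ∑ j : Fin n, ((n + k : ℕ) : ℂ) * ∑ p, if p j = 0 then F p else 0 :=
        Finset.sum_congr rfl fun j _ => h1 j
      _ = _ := by rw [← Finset.mul_sum, Finset.sum_comm]
  rw [h3]
  congr 1
  have h4 : (n.factorial : ℂ) * ∑ a : Weight n k, F a.residues =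
      ∑ x : Weight n k × Equiv.Perm (Fin n), F (x.1.residues ∘ x.2) := by
    rw [Fintype.sum_prod_type]
    simp [hperm, Fintype.card_perm, Finset.mul_sum]
  have h5 : ∀ p : Fin n → ZMod (n + k), (∑ j : Fin n, if p j = 0 then F p else 0) =
      if Function.Injective p ∧ ∃ j, p j = 0 then F p else 0 := by
    intro p
    by_cases hp : Function.Injective p
    · by_cases h0 : ∃ j, p j = 0
      · obtain ⟨j₀, hj₀⟩ := h0
        rw [if_pos ⟨hp, j₀, hj₀⟩, Finset.sum_eq_single j₀, if_pos hj₀]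
        · intro j _ hj
          exact if_neg fun h => hj (hp (h.trans hj₀.symm))
        · simp
      · rw [if_neg (fun h => h0 h.2)]
        exact Finset.sum_eq_zero fun j _ => if_neg fun h => h0 ⟨j, h⟩
    · simp [hinj p hp]
  rw [h4, Finset.sum_congr rfl fun p _ => h5 p, ← Finset.sum_filter]
  symm
  refine Finset.sum_bij (fun x _ => x.1.residues ∘ x.2) ?_ ?_ ?_ (fun _ _ => rfl)
  · rintro ⟨a, w⟩ _
    refine Finset.mem_filter.2 ⟨Finset.mem_univ _, ?_, ?_⟩
    · refine Function.Injective.comp (fun i j hij => ?_) w.injective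
      exact a.expo_strictAnti.injective ((cast_inj_of_lt (a.expo_lt i) (a.expo_lt j)).1 hij)
    · refine ⟨w.symm ⟨n - 1, by omega⟩, ?_⟩
      simp only [Function.comp_apply, Equiv.apply_symm_apply, Weight.residues]
      rw [a.expo_of_eq (by simp only; omega), Nat.cast_zero]
  · rintro ⟨a, w⟩ _ ⟨b, w'⟩ _ h
    have h' : a.expo ∘ w = b.expo ∘ w' := funext fun i =>
      (cast_inj_of_lt (a.expo_lt _) (b.expo_lt _)).1 (congrFun h i)
    obtain ⟨h1, rfl⟩ := strictAnti_eq_of_comp_eq a.expo_strictAnti b.expo_strictAnti h'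
    rw [expo_injective h1]
  · intro p hp
    obtain ⟨_, hp, j, hj⟩ := Finset.mem_filter.1 hp
    have hv : Function.Injective fun i => (p i).val :=
      (ZMod.val_injective (n + k)).comp hp
    obtain ⟨w, hw⟩ := exists_strictAnti_comp hv
    obtain ⟨a, ha⟩ := exists_weight_expo_eq (k := k) hw (fun l => ZMod.val_lt _)
      ⟨w.symm j, by simp [hj]⟩
    refine ⟨⟨a, w.symm⟩, Finset.mem_univ _, funext fun i => ?_⟩
    simp [Weight.residues, ha]

/-! ## Points attached to weights -/

/-- The mean value of the exponents. -/
def Weight.mean (s : Weight n k) : ℝ := (∑ l, (s.expo l : ℝ)) / n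

/-- The numbers `exp (-2πi (σ+ρ)_j / (k+n))`. -/
def Weight.point (s : Weight n k) (j : Fin n) : ℂ :=
  Complex.exp (-(2 * Real.pi * Complex.I / (k + n)) * ((s.expo j - s.mean : ℝ) : ℂ))

theorem point_rotate [NeZero n] (s : Weight n k) (l : Fin n) :
    (rotate n k s).point l =
      Complex.exp (-(2 * Real.pi * Complex.I / n)) * s.point (finRotate n l) := by
  obtain ⟨c, hc⟩ := expo_rotate s
  have hn : (n : ℝ) ≠ 0 := Nat.cast_ne_zero.2 (NeZero.ne n)
  have hmean : (rotate n k s).mean = s.mean + c - ((k : ℝ) + n) / n := by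
    have hite : ∑ l : Fin n, (if (l : ℕ) + 1 = n then ((k : ℝ) + n) else 0) = k + n := by
      rw [Finset.sum_eq_single (⟨n - 1, Nat.sub_lt (NeZero.pos n) one_pos⟩ : Fin n)]
      · exact if_pos (Nat.sub_add_cancel (NeZero.pos n))
      · intro j _ hj
        exact if_neg fun h => hj (Fin.ext (by simp only; omega))
      · simp
    unfold Weight.mean
    simp only [hc]
    rw [Finset.sum_sub_distrib, Finset.sum_add_distrib,
      Equiv.sum_comp (finRotate n) (fun l => (s.expo l : ℝ)), hite]
    simp only [Finset.sum_const, Finset.card_univ, Fintype.card_fin, nsmul_eq_mul]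
    field_simp
  have hnc : (n : ℂ) ≠ 0 := Nat.cast_ne_zero.2 (NeZero.ne n)
  have hkn : (k : ℂ) + n ≠ 0 := by
    rw [← Nat.cast_add]
    exact Nat.cast_ne_zero.2 (by have := NeZero.pos n; omega)
  unfold Weight.point
  rw [← Complex.exp_add, hc, hmean]
  split_ifs with h
  -- At the wrapped exponent the extra k + n is a full period of the exponential.
  · rw [← Complex.exp_periodic.sub_eq]
    congr 1
    push_cast
    field_simp
    ring
  · congr 1
    push_cast
    field_simp
    ring

theorem alternant_smul {A : Type*} [CommRing A] (c : A) (x : Fin n → A) (l : Fin n → ℕ) :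
    alternant (fun j => c * x j) l = c ^ (∑ i, l i) * alternant x l := by
  unfold alternant
  rw [← Finset.prod_pow_eq_pow_sum, ← Matrix.det_mul_column]
  congr 1
  ext i j
  simp [mul_pow]

theorem alternant_rotate [NeZero n] (s : Weight n k) (l : Fin n → ℕ) :
    alternant (rotate n k s).point l = ((Equiv.Perm.sign (finRotate n) : ℤ) : ℂ) *
      (Complex.exp (-(2 * Real.pi * Complex.I / n)) ^ (∑ i, l i) * alternant s.point l) := by
  rw [← alternant_smul, ← alternant_perm_comp]
  congr 1
  funext j
  exact point_rotate s j

theorem conj_alternant (x : Fin n → ℂ) (l : Fin n → ℕ) :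
    (starRingEnd ℂ) (alternant x l) = alternant (fun j => (starRingEnd ℂ) (x j)) l :=
  map_alternant _ _ _

/-- Rotation permutes the weights and multiplies each summand by exp(-2πi/n) to the power ∑ l - ∑
l'; the two signs cancel. If n does not divide this power, the factor is not 1 and the sum vanishes.
-/
theorem sum_alternant_eq_zero [NeZero n] {l l' : Fin n → ℕ}
    (h : ¬ (n : ℤ) ∣ (∑ i, (l i : ℤ)) - ∑ i, (l' i : ℤ)) :
    ∑ s : Weight n k, alternant s.point l * (starRingEnd ℂ) (alternant s.point l') = 0 := by
  set z := Complex.exp (-(2 * Real.pi * Complex.I / n)) with hz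
  set c := z ^ (∑ i, l i) * (starRingEnd ℂ) z ^ (∑ i, l' i) with hc
  have hn : (n : ℂ) ≠ 0 := Nat.cast_ne_zero.2 (NeZero.ne n)
  have hrot : ∑ s : Weight n k, alternant s.point l * (starRingEnd ℂ) (alternant s.point l') =
      c * ∑ s : Weight n k, alternant s.point l * (starRingEnd ℂ) (alternant s.point l') := by
    conv_lhs => rw [← Equiv.sum_comp (rotate n k)]
    rw [Finset.mul_sum]
    refine Finset.sum_congr rfl fun s _ => ?_
    rw [alternant_rotate, alternant_rotate]
    simp only [map_mul, map_pow, map_intCast]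
    have h1 := sign_mul_sign (finRotate n) (1 : ℂ)
    rw [mul_one] at h1
    rw [hc]
    linear_combination (z ^ (∑ i, l i) * (starRingEnd ℂ) z ^ (∑ i, l' i) *
      (alternant s.point l * (starRingEnd ℂ) (alternant s.point l'))) * h1
  have hc1 : c ≠ 1 := by
    rw [hc, hz, ← Complex.exp_conj, ← Complex.exp_nat_mul, ← Complex.exp_nat_mul,
      ← Complex.exp_add]
    intro h1
    obtain ⟨m, hm⟩ := Complex.exp_eq_one_iff.1 h1
    apply h
    refine ⟨-m, ?_⟩
    have hpi : (2 * Real.pi * Complex.I : ℂ) ≠ 0 := Complex.two_pi_I_ne_zero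
    simp only [map_neg, map_div₀, map_mul, Complex.conj_ofReal, Complex.conj_I, map_natCast,
      map_ofNat] at hm
    have h2 : (((∑ i, (l i : ℤ)) - ∑ i, (l' i : ℤ) : ℤ) : ℂ) = ((n * -m : ℤ) : ℂ) := by
      push_cast at hm ⊢
      field_simp at hm
      have hI := Complex.I_ne_zero
      linear_combination -hm
    exact_mod_cast h2
  have := sub_eq_zero.2 hrot
  rw [← one_sub_mul] at this
  exact (mul_eq_zero.1 this).resolve_left (sub_ne_zero.2 hc1.symm)

/-- Points are not characters of ℤ/(n+k), because the mean is subtracted from the exponents. The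
leftover phases multiply to exp(2πi · nd · mean/(k+n)); since n · mean is the sum of the exponents,
this is a character value, absorbed by shifting `l'` by d. -/
theorem alternant_mul_conj_eq [NeZero n] (s : Weight n k) {l l' : Fin n → ℕ} {d : ℤ}
    (h : (∑ i, (l i : ℤ)) - ∑ i, (l' i : ℤ) = n * d) :
    alternant s.point l * (starRingEnd ℂ) (alternant s.point l') =
      charDet s.residues (fun i => -(l i : ZMod (n + k))) *
        charDet s.residues (fun i => (l' i : ZMod (n + k)) + d) := by
  have hn : (n : ℂ) ≠ 0 := Nat.cast_ne_zero.2 (NeZero.ne n)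
  have hkn : (k : ℂ) + n ≠ 0 := by
    rw [← Nat.cast_add]
    exact Nat.cast_ne_zero.2 (by have := NeZero.pos n; omega)
  set z := Complex.exp (2 * Real.pi * Complex.I / (k + n) * (s.mean : ℂ)) with hz
  have hp : s.point = fun j => z * ZMod.stdAddChar (-s.residues j) := by
    funext j
    have h1 := ZMod.stdAddChar_coe (N := n + k) (-(s.expo j : ℤ))
    push_cast at h1
    rw [add_comm (n : ℂ)] at h1
    rw [Weight.residues, h1, hz, ← Complex.exp_add, Weight.point]
    congr 1
    push_cast
    field_simp
    ring
  have hcp : (fun j => (starRingEnd ℂ) (s.point j)) =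
      fun j => z⁻¹ * ZMod.stdAddChar (s.residues j) := by
    funext j
    have h1 := ZMod.stdAddChar_coe (N := n + k) (s.expo j : ℤ)
    push_cast at h1
    rw [add_comm (n : ℂ)] at h1
    rw [Weight.residues, h1, hz, ← Complex.exp_neg, ← Complex.exp_add, Weight.point,
      ← Complex.exp_conj]
    congr 1
    simp only [map_mul, map_neg, map_div₀, map_add, Complex.conj_ofReal, Complex.conj_I,
      map_natCast, map_ofNat]
    push_cast
    field_simp
    ring
  have h1 : alternant (fun j => (ZMod.stdAddChar (-s.residues j) : ℂ)) l =
      charDet s.residues (fun i => -(l i : ZMod (n + k))) := by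
    unfold alternant charDet
    congr 1
    ext i j
    simp only [Matrix.of_apply]
    rw [← AddChar.map_nsmul_eq_pow, nsmul_eq_mul]
    ring_nf
  have h2 : alternant (fun j => (ZMod.stdAddChar (s.residues j) : ℂ)) l' =
      charDet s.residues (fun i => (l' i : ZMod (n + k))) := by
    unfold alternant charDet
    congr 1
    ext i j
    simp only [Matrix.of_apply]
    rw [← AddChar.map_nsmul_eq_pow, nsmul_eq_mul]
    ring_nf
  rw [conj_alternant, hcp, hp, alternant_smul, alternant_smul, h1, h2, charDet_add_const_right]
  have h3 : z ^ (∑ i, l i) * z⁻¹ ^ (∑ i, l' i) =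
      ZMod.stdAddChar ((d : ZMod (n + k)) * ∑ j, s.residues j) := by
    have h4 := ZMod.stdAddChar_coe (N := n + k) (d * ∑ j, (s.expo j : ℤ))
    push_cast at h4
    rw [add_comm (n : ℂ)] at h4
    unfold Weight.residues
    rw [h4, hz, ← Complex.exp_neg, ← Complex.exp_nat_mul, ← Complex.exp_nat_mul,
      ← Complex.exp_add]
    congr 1
    have h5 : (((∑ i, (l i : ℤ)) - ∑ i, (l' i : ℤ) : ℤ) : ℂ) = ((n * d : ℤ) : ℂ) := by rw [h]
    push_cast at h5 ⊢
    have h6 : (∑ j, (s.expo j : ℂ)) = n * (s.mean : ℂ) := by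
      rw [Weight.mean]
      push_cast
      field_simp
    rw [h6]
    field_simp
    linear_combination (s.mean : ℂ) * h5
  rw [← h3]
  ring

/-! ## Orthogonality -/

/-- Write J'_i + d - J_i = N q_i; then ∑ q_i = 0. If d > 0, the bounds force all q_i ≥ 0, with q_i >
0 where J_i = 0, a contradiction; d < 0 is symmetric. So d = 0, and residues determine the entries.
-/
theorem eq_of_congr_of_sum_eq {N : ℕ} [NeZero N] {J J' : Fin n → ℕ} (hJ : ∀ i, J i < N)
    (hJ' : ∀ i, J' i < N) (h0 : ∃ i, J i = 0) (h0' : ∃ i, J' i = 0) {d : ℤ}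
    (hd : (∑ i, (J i : ℤ)) - ∑ i, (J' i : ℤ) = n * d)
    (h : ∀ i, -(J i : ZMod N) + ((J' i : ZMod N) + d) = 0) : J = J' := by
  have hN : (0 : ℤ) < N := by exact_mod_cast NeZero.pos N
  have hq : ∀ i, ∃ q : ℤ, -(J i : ℤ) + (J' i + d) = N * q := fun i => by
    have h1 : ((-(J i : ℤ) + (J' i + d) : ℤ) : ZMod N) = 0 := by
      push_cast
      exact h i
    exact (ZMod.intCast_zmod_eq_zero_iff_dvd _ N).1 h1
  choose q hq using hq
  have hsum : ∑ i, q i = 0 := by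
    have h1 : (N : ℤ) * ∑ i, q i = 0 := by
      rw [Finset.mul_sum, ← Finset.sum_congr rfl fun i _ => hq i]
      simp only [Finset.sum_add_distrib, Finset.sum_neg_distrib, Finset.sum_const,
        Finset.card_univ, Fintype.card_fin, nsmul_eq_mul]
      linarith
    exact (mul_eq_zero.1 h1).resolve_left hN.ne'
  have hd0 : d = 0 := by
    rcases lt_trichotomy d 0 with hlt | h1 | hgt
    · exfalso
      obtain ⟨i, hi⟩ := h0'
      have hneg : ∀ j, q j ≤ 0 := fun j => by
        have h1 := hq j
        have h2 : (J' j : ℤ) < N := by exact_mod_cast hJ' j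
        have h3 : (0 : ℤ) ≤ J j := Int.natCast_nonneg _
        by_contra hc
        nlinarith
      have h1 := hq i
      have h3 : (0 : ℤ) ≤ J i := Int.natCast_nonneg _
      have h4 : q i < 0 := by
        by_contra hc
        have : (J' i : ℤ) = 0 := by exact_mod_cast hi
        nlinarith
      have := Finset.sum_neg' (fun j _ => hneg j) ⟨i, Finset.mem_univ i, h4⟩
      omega
    · exact h1
    · exfalso
      obtain ⟨i, hi⟩ := h0
      have hpos : ∀ j, 0 ≤ q j := fun j => by
        have h1 := hq j
        have h2 : (J j : ℤ) < N := by exact_mod_cast hJ j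
        have h3 : (0 : ℤ) ≤ J' j := Int.natCast_nonneg _
        by_contra hc
        nlinarith
      have h1 := hq i
      have h3 : (0 : ℤ) ≤ J' i := Int.natCast_nonneg _
      have h4 : 0 < q i := by
        by_contra hc
        have : (J i : ℤ) = 0 := by exact_mod_cast hi
        nlinarith
      have := Finset.sum_pos' (fun j _ => hpos j) ⟨i, Finset.mem_univ i, h4⟩
      omega
  funext i
  have h1 := h i
  rw [hd0, Int.cast_zero, add_zero] at h1
  exact (cast_inj_of_lt (hJ i) (hJ' i)).1 (neg_add_eq_zero.1 h1)

theorem Weight.exists_expo_eq_zero [NeZero n] (a : Weight n k) : ∃ i, a.expo i = 0 :=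
  ⟨⟨n - 1, Nat.sub_lt (NeZero.pos n) one_pos⟩,
    a.expo_of_eq (Nat.sub_add_cancel (NeZero.pos n))⟩

theorem expo_comp_eq_of_congr [NeZero n] (a c : Weight n k) {d : ℤ}
    (hd : (∑ i, (a.expo i : ℤ)) - ∑ i, (c.expo i : ℤ) = n * d) {w w' : Equiv.Perm (Fin n)}
    (h : ∀ i, -(a.expo (w i) : ZMod (n + k)) + ((c.expo (w' i) : ZMod (n + k)) + d) = 0) :
    a = c ∧ w = w' := by
  obtain ⟨i, hi⟩ := a.exists_expo_eq_zero
  obtain ⟨i', hi'⟩ := c.exists_expo_eq_zero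
  have h1 := eq_of_congr_of_sum_eq (J := a.expo ∘ w) (J' := c.expo ∘ w') (N := n + k)
    (fun i => a.expo_lt _) (fun i => c.expo_lt _) ⟨w.symm i, by simp [hi]⟩
    ⟨w'.symm i', by simp [hi']⟩ (d := d) (by
      rw [← hd]
      simp only [Function.comp_apply]
      rw [Equiv.sum_comp w (fun i => (a.expo i : ℤ)), Equiv.sum_comp w' (fun i => (c.expo i : ℤ))])
    h
  obtain ⟨h2, h3⟩ := strictAnti_eq_of_comp_eq a.expo_strictAnti c.expo_strictAnti h1
  exact ⟨expo_injective h2, h3⟩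

/-- If the exponent sums differ modulo n, rotation kills the sum. Otherwise the summand is a product
of two character determinants and the sum extends to all tuples, where only pairs w = w' with a = c
contribute: n! terms, each (n+k)^n. -/
theorem sum_alternant_mul_conj [NeZero n] (a c : Weight n k) :
    ∑ s : Weight n k, alternant s.point a.expo * (starRingEnd ℂ) (alternant s.point c.expo) =
      if a = c then (n : ℂ) * ((k : ℂ) + n) ^ (n - 1) else 0 := by
  classical
  have hn0 : n ≠ 0 := NeZero.ne n
  by_cases hdvd : (n : ℤ) ∣ (∑ i, (a.expo i : ℤ)) - ∑ i, (c.expo i : ℤ)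
  swap
  · rw [sum_alternant_eq_zero hdvd, if_neg]
    rintro rfl
    exact hdvd (by simp)
  obtain ⟨d, hd⟩ := hdvd
  rw [Finset.sum_congr rfl fun s _ => alternant_mul_conj_eq s hd]
  set u : Fin n → ZMod (n + k) := fun i => -(a.expo i : ZMod (n + k)) with hu
  set v : Fin n → ZMod (n + k) := fun i => (c.expo i : ZMod (n + k)) + d with hv
  -- This cancels the characters produced by a common shift of the tuple, giving the invariance
  -- needed by `sum_tuples_eq`.
  have huv : ∑ i, u i + ∑ i, v i = 0 := by
    have h1 := congrArg (Int.cast : ℤ → ZMod (n + k)) hd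
    push_cast at h1
    simp only [hu, hv, Finset.sum_add_distrib, Finset.sum_neg_distrib, Finset.sum_const,
      Finset.card_univ, Fintype.card_fin, nsmul_eq_mul]
    linear_combination -h1
  have key := sum_tuples_eq (k := k) (F := fun p => charDet p u * charDet p v)
    (fun p hp => by simp only [charDet_eq_zero hp, zero_mul])
    (fun p w => by
      simp only [charDet_comp_perm]
      have h1 := sign_mul_sign w (1 : ℂ)
      rw [mul_one] at h1
      linear_combination (charDet p u * charDet p v) * h1)
    (fun p e => by
      simp only [charDet_add_const_left]
      rw [mul_mul_mul_comm, ← AddChar.map_add_eq_mul, ← mul_add, huv, mul_zero,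
        AddChar.map_zero_eq_one, one_mul])
  rw [sum_charDet_mul_charDet] at key
  have hN : ((n + k : ℕ) : ℂ) ≠ 0 := Nat.cast_ne_zero.2 (by omega)
  have hf : (n.factorial : ℂ) ≠ 0 := Nat.cast_ne_zero.2 n.factorial_ne_zero
  have hprod : ∀ w w' : Equiv.Perm (Fin n),
      (∏ j, if u (w j) + v (w' j) = 0 then ((n + k : ℕ) : ℂ) else 0) ≠ 0 → a = c ∧ w = w' := by
    intro w w' h
    refine expo_comp_eq_of_congr a c hd fun i => ?_
    by_contra hi
    exact h (Finset.prod_eq_zero (Finset.mem_univ i) (if_neg hi))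
  by_cases hac : a = c
  · rw [if_pos hac]
    have hd0 : d = 0 := by
      subst hac
      rw [sub_self] at hd
      exact (mul_eq_zero.1 hd.symm).resolve_left (by exact_mod_cast hn0)
    have h1 : ∀ w w' : Equiv.Perm (Fin n),
        ((Equiv.Perm.sign w : ℤ) : ℂ) * ((Equiv.Perm.sign w' : ℤ) : ℂ) *
          (∏ j, if u (w j) + v (w' j) = 0 then ((n + k : ℕ) : ℂ) else 0) =
        if w = w' then ((n + k : ℕ) : ℂ) ^ n else 0 := by
      intro w w'
      split_ifs with hw
      · subst hw
        have h2 := sign_mul_sign w (1 : ℂ)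
        rw [mul_one] at h2
        rw [h2, one_mul, Finset.prod_congr rfl fun j _ => if_pos ?_]
        · simp
        · simp [hu, hv, hac, hd0]
      · by_contra h
        exact hw (hprod w w' (right_ne_zero_of_mul h)).2
    simp only [h1, Finset.sum_ite_eq, Finset.mem_univ, if_true, Finset.sum_const,
      Finset.card_univ, Fintype.card_perm, Fintype.card_fin, nsmul_eq_mul] at key
    have hpow : ((n + k : ℕ) : ℂ) ^ n = ((n + k : ℕ) : ℂ) * ((n + k : ℕ) : ℂ) ^ (n - 1) := by
      rw [← pow_succ', Nat.sub_add_cancel (NeZero.pos n)]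
    rw [hpow] at key
    have h3 : ((n + k : ℕ) : ℂ) = (k : ℂ) + n := by push_cast; ring
    rw [← h3]
    refine mul_left_cancel₀ (mul_ne_zero hN hf) ?_
    linear_combination -key
  · rw [if_neg hac]
    have h1 : ∀ w w' : Equiv.Perm (Fin n),
        ((Equiv.Perm.sign w : ℤ) : ℂ) * ((Equiv.Perm.sign w' : ℤ) : ℂ) *
          (∏ j, if u (w j) + v (w' j) = 0 then ((n + k : ℕ) : ℂ) else 0) = 0 := by
      intro w w'
      by_contra h
      exact hac (hprod w w' (right_ne_zero_of_mul h)).1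
    simp only [h1, Finset.sum_const_zero, mul_zero] at key
    exact (mul_eq_zero.1 ((mul_eq_zero.1 key.symm).resolve_left hN)).resolve_left hf

/-! ## The modular S-matrix -/

/-- The scalar prefactor of the modular S-matrix. -/
def prefactor (n k : ℕ) : ℂ :=
  Complex.exp (Real.pi * Complex.I * (n * (n - 1) / 4)) /
    (Real.sqrt ((n : ℝ) * ((k : ℝ) + n) ^ (n - 1)) : ℝ)

theorem sum_stair (n : ℕ) : ∑ l : Fin n, (stair n l : ℝ) = n * (((n : ℝ) - 1) / 2) := by
  have h3 : ∑ l : Fin n, (stair n l : ℝ) = ∑ l : Fin n, ((l : ℕ) : ℝ) :=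
    Equiv.sum_comp Fin.revPerm (fun l : Fin n => ((l : ℕ) : ℝ))
  rw [h3, Fin.sum_univ_eq_sum_range (fun l => (l : ℝ)) n]
  clear h3
  induction n with
  | zero => simp
  | succ n ih =>
    rw [Finset.sum_range_succ, ih]
    push_cast
    ring

theorem sum_expo (a : Weight n k) :
    ∑ l, (a.expo l : ℝ) = (∑ i, (a.1 i : ℝ) * i) + n * (((n : ℝ) - 1) / 2) := by
  have h1 : ∑ l : Fin n, (a.part l : ℝ) = ∑ i, (a.1 i : ℝ) * i := by
    simp only [Weight.part_eq_sum]
    push_cast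
    rw [Finset.sum_comm]
    refine Finset.sum_congr rfl fun i _ => ?_
    rw [← Finset.sum_filter, Finset.sum_const, Fin.card_filter_val_lt, nsmul_eq_mul,
      Nat.min_eq_right i.2.le, mul_comm]
  unfold Weight.expo
  push_cast
  rw [Finset.sum_add_distrib, h1, sum_stair]

theorem finitePart_add_weylVector [NeZero n] (a : Weight n k) (l : Fin n) :
    (a.finitePart + weylVector n) l = a.expo l - a.mean := by
  have hn : (n : ℝ) ≠ 0 := Nat.cast_ne_zero.2 (NeZero.ne n)
  have h1 : a.finitePart l = a.part l - (∑ i, (a.1 i : ℝ) * i) / n := by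
    unfold Weight.finitePart fundamentalWeight
    rw [Finset.sum_apply, a.part_eq_sum]
    push_cast
    rw [Finset.sum_div, ← Finset.sum_sub_distrib]
    refine Finset.sum_congr rfl fun i _ => ?_
    simp only [Pi.smul_apply, smul_eq_mul, Fin.lt_def]
    split_ifs <;> ring
  have h2 : (stair n l : ℝ) = n - 1 - l := by
    have := l.2
    have h3 : stair n l + l + 1 = n := by simp only [stair, Fin.val_rev]; omega
    have h4 : ((stair n l + l + 1 : ℕ) : ℝ) = n := by rw [h3]
    push_cast at h4
    linarith
  rw [Pi.add_apply, h1, weylVector, Weight.mean, sum_expo, Weight.expo]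
  push_cast
  rw [h2]
  field_simp
  ring

theorem sum_expo_sub_mean [NeZero n] (s : Weight n k) :
    ∑ j, ((s.expo j : ℝ) - s.mean) = 0 := by
  have hn : (n : ℝ) ≠ 0 := Nat.cast_ne_zero.2 (NeZero.ne n)
  rw [Finset.sum_sub_distrib, Finset.sum_const, Finset.card_univ, Fintype.card_fin, nsmul_eq_mul,
    Weight.mean, mul_div_cancel₀ _ hn, sub_self]

theorem modularS_eq [NeZero n] (a s : Weight n k) :
    modularS a s = prefactor n k * alternant s.point a.expo := by
  unfold modularS prefactor alternant
  rw [Matrix.det_apply', ← Equiv.sum_comp (Equiv.inv (Equiv.Perm (Fin n)))]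
  congr 1
  refine Finset.sum_congr rfl fun w _ => ?_
  rw [Equiv.inv_apply, Equiv.Perm.sign_inv, inv_inv]
  congr 1
  simp only [finitePart_add_weylVector, Matrix.of_apply, Weight.point]
  simp only [← Complex.exp_nat_mul]
  rw [← Complex.exp_sum]
  congr 1
  -- The coordinates of σ + ρ sum to 0, so the mean of `a` drops out and integral exponents remain.
  have h1 : ∑ j, ((s.expo j : ℝ) - s.mean) * ((a.expo (w j) : ℝ) - a.mean) =
      ∑ j, ((s.expo j : ℝ) - s.mean) * (a.expo (w j) : ℝ) := by
    simp only [mul_sub]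
    rw [Finset.sum_sub_distrib, ← Finset.sum_mul, sum_expo_sub_mean, zero_mul, sub_zero]
  rw [h1]
  push_cast
  rw [Finset.mul_sum]
  exact Finset.sum_congr rfl fun j _ => by ring

theorem prod_point [NeZero n] (s : Weight n k) : ∏ j, s.point j = 1 := by
  unfold Weight.point
  rw [← Complex.exp_sum, ← Finset.mul_sum, ← Complex.ofReal_sum, sum_expo_sub_mean]
  simp

theorem conj_point (s : Weight n k) (j : Fin n) :
    (starRingEnd ℂ) (s.point j) = (s.point j)⁻¹ := by
  unfold Weight.point
  rw [← Complex.exp_conj, ← Complex.exp_neg]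
  congr 1
  simp only [map_mul, map_neg, map_div₀, map_add, Complex.conj_ofReal, Complex.conj_I,
    map_natCast, map_ofNat]
  ring

theorem sign_revPerm (n : ℕ) :
    ((Equiv.Perm.sign (Fin.revPerm : Equiv.Perm (Fin n)) : ℤ) : ℂ) =
      Complex.exp (Real.pi * Complex.I * (n * (n - 1) / 2)) := by
  have h1 : Equiv.Perm.sign (Fin.revPerm : Equiv.Perm (Fin n)) =
      (-1) ^ (∑ l : Fin n, stair n l) := by
    rw [Equiv.Perm.sign_eq_prod_prod_Ioi, ← Finset.prod_pow_eq_pow_sum]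
    refine Finset.prod_congr rfl fun i _ => ?_
    rw [Finset.prod_congr rfl (g := fun _ => (-1 : ℤˣ)), Finset.prod_const, Fin.card_Ioi]
    · simp only [stair, Fin.val_rev]
      congr 1
      omega
    · intro j hj
      rw [if_neg]
      simp only [Fin.revPerm_apply, Fin.rev_lt_rev, not_lt]
      exact (Finset.mem_Ioi.1 hj).le
  have h2 : ((∑ l : Fin n, stair n l : ℕ) : ℂ) = n * (n - 1) / 2 := by
    have := congrArg (Complex.ofReal) (sum_stair n)
    push_cast at this ⊢
    rw [this]
    ring
  rw [h1, ← h2, mul_comm, Complex.exp_nat_mul, Complex.exp_pi_mul_I]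
  push_cast
  rfl

/-- The points lie on the unit circle, so conjugation inverts them. As their product is 1, all
exponents may be raised by `c.expo 0`, which turns the negated exponents into those of the conjugate
weight in reversed order. -/
theorem alternant_conj [NeZero n] (c s : Weight n k) :
    alternant s.point c.conj.expo =
      ((Equiv.Perm.sign (Fin.revPerm : Equiv.Perm (Fin n)) : ℤ) : ℂ) *
        (starRingEnd ℂ) (alternant s.point c.expo) := by
  rw [conj_alternant, ← alternant_comp_perm]
  unfold alternant
  have h1 := Matrix.det_mul_row (fun j => s.point j ^ c.expo 0)
    (Matrix.of fun i j => (starRingEnd ℂ) (s.point j) ^ (c.expo ∘ Fin.revPerm) i)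
  rw [Finset.prod_pow, prod_point, one_pow, one_mul] at h1
  rw [← h1]
  congr 1
  ext i j
  have h2 := expo_conj c i
  have h3 : s.point j ≠ 0 := Complex.exp_ne_zero _
  simp only [Matrix.of_apply, Function.comp_apply, Fin.revPerm_apply]
  rw [conj_point, ← h2, pow_add, mul_assoc, ← mul_pow, mul_inv_cancel₀ h3, one_pow, mul_one]

theorem prefactor_ne_zero [NeZero n] : prefactor n k ≠ 0 := by
  have hn : (0 : ℝ) < n := Nat.cast_pos.2 (NeZero.pos n)
  refine div_ne_zero (Complex.exp_ne_zero _) ?_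
  rw [Complex.ofReal_ne_zero]
  have : (0 : ℝ) < (n : ℝ) * ((k : ℝ) + n) ^ (n - 1) := by positivity
  exact (Real.sqrt_pos.2 this).ne'

/-- The square of exp(πi n(n-1)/4) is the sign of the reversal, so the sign from `alternant_conj`
cancels. -/
theorem prefactor_mul_sign [NeZero n] :
    prefactor n k * prefactor n k *
      ((Equiv.Perm.sign (Fin.revPerm : Equiv.Perm (Fin n)) : ℤ) : ℂ) *
        ((n : ℂ) * ((k : ℂ) + n) ^ (n - 1)) = 1 := by
  rw [sign_revPerm]
  unfold prefactor
  have hn : (0 : ℝ) < n := Nat.cast_pos.2 (NeZero.pos n)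
  set q : ℝ := (n : ℝ) * ((k : ℝ) + n) ^ (n - 1) with hq
  have hq0 : 0 < q := by positivity
  have h1 : ((n : ℂ) * ((k : ℂ) + n) ^ (n - 1)) = ((Real.sqrt q : ℝ) : ℂ) * (Real.sqrt q : ℝ) := by
    rw [← Complex.ofReal_mul, Real.mul_self_sqrt hq0.le, hq]
    push_cast
    rfl
  have h2 : ((Real.sqrt q : ℝ) : ℂ) ≠ 0 := Complex.ofReal_ne_zero.2 (Real.sqrt_pos.2 hq0).ne'
  have h3 : Complex.exp (Real.pi * Complex.I * (n * (n - 1) / 4)) *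
      Complex.exp (Real.pi * Complex.I * (n * (n - 1) / 4)) =
        ((Equiv.Perm.sign (Fin.revPerm : Equiv.Perm (Fin n)) : ℤ) : ℂ) := by
    rw [sign_revPerm, ← Complex.exp_add]
    congr 1
    ring
  have h4 := sign_mul_sign (Fin.revPerm : Equiv.Perm (Fin n)) (1 : ℂ)
  rw [mul_one] at h4
  rw [h1, ← sign_revPerm, div_mul_div_comm, h3]
  field_simp
  rw [pow_two, h4]

/-- Unitarity of the modular S-matrix. -/
theorem sum_modularS_mul [NeZero n] (a c : Weight n k) :
    ∑ s, modularS a s * modularS c.conj s = if a = c then 1 else 0 := by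
  have h := sum_alternant_mul_conj a c
  have h1 : ∀ s : Weight n k, modularS a s * modularS c.conj s =
      prefactor n k * prefactor n k *
      ((Equiv.Perm.sign (Fin.revPerm : Equiv.Perm (Fin n)) : ℤ) : ℂ) *
      (alternant s.point a.expo * (starRingEnd ℂ) (alternant s.point c.expo)) := fun s => by
    rw [modularS_eq, modularS_eq, alternant_conj]
    ring
  rw [Finset.sum_congr rfl fun s _ => h1 s, ← Finset.mul_sum, h]
  split_ifs
  · exact prefactor_mul_sign
  · rw [mul_zero]

/-- The `(n+k)`-th roots `exp (-2πi (c - m) / (k+n))` of `exp (2πi m)`. -/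
def rootAt (n k : ℕ) (m : ℝ) (c : ℕ) : ℂ :=
  Complex.exp (-(2 * Real.pi * Complex.I / (k + n)) * ((c - m : ℝ) : ℂ))

theorem rootAt_injOn {m : ℝ} {c c' : ℕ} (hc : c < n + k) (hc' : c' < n + k)
    (h : rootAt n k m c = rootAt n k m c') : c = c' := by
  have hkn : (k : ℂ) + n ≠ 0 := by
    rw [← Nat.cast_add]
    exact Nat.cast_ne_zero.2 (by omega)
  obtain ⟨q, hq⟩ := Complex.exp_eq_exp_iff_exists_int.1 h
  have h1 : ((c' : ℤ) - c : ℤ) = ((n + k : ℕ) : ℤ) * q := by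
    have hI := Complex.I_ne_zero
    have hpi : (Real.pi : ℂ) ≠ 0 := Complex.ofReal_ne_zero.2 Real.pi_ne_zero
    push_cast at hq
    field_simp at hq
    have h2 : (((c' : ℤ) - c : ℤ) : ℂ) = ((((n + k : ℕ) : ℤ) * q : ℤ) : ℂ) := by
      push_cast
      linear_combination hq
    exact_mod_cast h2
  have h3 : (c : ZMod (n + k)) = (c' : ZMod (n + k)) := by
    have h4 := congrArg (Int.cast : ℤ → ZMod (n + k)) h1
    rw [Int.cast_mul, Int.cast_natCast, ZMod.natCast_self, zero_mul] at h4
    push_cast at h4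
    exact (sub_eq_zero.1 h4).symm
  exact (cast_inj_of_lt hc hc').1 h3

theorem point_injective (s : Weight n k) : Function.Injective s.point := fun i j h =>
  s.expo_strictAnti.injective (rootAt_injOn (s.expo_lt i) (s.expo_lt j) h)

theorem vacuum_part_eq_zero [NeZero n] (i : ℕ) : (vacuum n k).part i = 0 := by
  refine Finset.sum_eq_zero fun j hj => ?_
  have h1 := (Finset.mem_filter.1 hj).2
  have h2 : j ≠ 0 := fun h => by simp [h] at h1
  simp [vacuum, h2]

theorem colLen_vacuum [NeZero n] (j : ℕ) : (vacuum n k).diagram.colLen j = 0 := by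
  by_contra h
  have h1 := ((vacuum n k).lt_colLen_iff 0 j).1 (Nat.pos_of_ne_zero h)
  rw [vacuum_part_eq_zero] at h1
  omega

theorem alternant_point_vacuum_ne_zero [NeZero n] (s : Weight n k) :
    alternant s.point (vacuum n k).expo ≠ 0 := by
  have h : (vacuum n k).expo = stair n := by
    funext l
    rw [Weight.expo, vacuum_part_eq_zero, zero_add]
  rw [h]
  exact alternant_stair_ne_zero (point_injective s)

/-! ## The permutation of exponents and complementary exponents -/

/-- The number `n + j - λᵗ_j`; these are the elements of `{0, …, n+k-1}` that are not exponents. -/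
def Weight.coexpo (a : Weight n k) (j : ℕ) : ℕ := n + j - a.diagram.colLen j

theorem Weight.expo_lt_coexpo_iff [NeZero n] (a : Weight n k) (l : Fin n) (j : ℕ) :
    a.expo l < a.coexpo j ↔ ¬ (l : ℕ) < a.diagram.colLen j := by
  have h1 := a.lt_colLen_iff l j
  have h2 := a.colLen_lt j
  simp only [Weight.expo, Weight.coexpo, stair, Fin.val_rev]
  by_cases h : (l : ℕ) < a.diagram.colLen j
  · have := h1.1 h
    omega
  · have : ¬ j < a.part l := fun h' => h (h1.2 h')
    omega

theorem Weight.expo_ne_coexpo [NeZero n] (a : Weight n k) (l : Fin n) (j : ℕ) :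
    a.expo l ≠ a.coexpo j := by
  have h1 := a.lt_colLen_iff l j
  have h2 := a.colLen_lt j
  simp only [Weight.expo, Weight.coexpo, stair, Fin.val_rev]
  by_cases h : (l : ℕ) < a.diagram.colLen j
  · have := h1.1 h
    omega
  · have : ¬ j < a.part l := fun h' => h (h1.2 h')
    omega

theorem Weight.coexpo_lt_coexpo [NeZero n] (a : Weight n k) {i j : ℕ} (h : i < j) :
    a.coexpo i < a.coexpo j := by
  have h1 := a.colLen_lt i
  have h2 := a.diagram.colLen_anti _ _ h.le
  simp only [Weight.coexpo]
  omega

theorem Weight.coexpo_lt (a : Weight n k) (j : Fin k) : a.coexpo j < n + k := by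
  simp only [Weight.coexpo]
  omega

/-- The permutation of `{0, …, n+k-1}` which lists the exponents of a weight in increasing order,
followed by the other numbers in increasing order. -/
def Weight.perm [NeZero n] (a : Weight n k) : Equiv.Perm (Fin (n + k)) :=
  Equiv.ofBijective
    (Fin.addCases (fun i : Fin n => ⟨a.expo i.rev, a.expo_lt _⟩)
      (fun j : Fin k => ⟨a.coexpo j, a.coexpo_lt j⟩))
    (Finite.injective_iff_bijective.1 (by
      intro x y hxy
      induction x using Fin.addCases with
      | left i =>
        induction y using Fin.addCases with
        | left i' =>
          simp only [Fin.addCases_left, Fin.mk.injEq] at hxy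
          rw [Fin.rev_injective (a.expo_strictAnti.injective hxy)]
        | right j =>
          simp only [Fin.addCases_left, Fin.addCases_right, Fin.mk.injEq] at hxy
          exact absurd hxy (a.expo_ne_coexpo _ _)
      | right j =>
        induction y using Fin.addCases with
        | left i' =>
          simp only [Fin.addCases_left, Fin.addCases_right, Fin.mk.injEq] at hxy
          exact absurd hxy.symm (a.expo_ne_coexpo _ _)
        | right j' =>
          simp only [Fin.addCases_right, Fin.mk.injEq] at hxy
          rcases lt_trichotomy (j : ℕ) j' with h | h | h
          · exact absurd hxy (a.coexpo_lt_coexpo h).ne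
          · rw [Fin.ext h]
          · exact absurd hxy (a.coexpo_lt_coexpo h).ne'))

theorem Weight.perm_castAdd [NeZero n] (a : Weight n k) (i : Fin n) :
    (a.perm (Fin.castAdd k i) : ℕ) = a.expo i.rev := by
  simp [Weight.perm]

theorem Weight.perm_natAdd [NeZero n] (a : Weight n k) (j : Fin k) :
    (a.perm (Fin.natAdd n j) : ℕ) = a.coexpo j := by
  simp [Weight.perm]

/-- Both blocks are increasing, so inversions occur only between them. By
`Weight.expo_lt_coexpo_iff` they correspond to the cells of the diagram. -/
theorem Weight.sign_perm [NeZero n] (a : Weight n k) :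
    Equiv.Perm.sign a.perm = (-1) ^ ∑ j : Fin k, a.diagram.colLen j := by
  have h : Equiv.Perm.sign a.perm = ∏ x : Fin (n + k), ∏ y : Fin (n + k),
      if x < y then (if a.perm x < a.perm y then 1 else -1) else 1 := by
    rw [Equiv.Perm.sign_eq_prod_prod_Ioi]
    refine Finset.prod_congr rfl fun x _ => ?_
    rw [← Finset.prod_filter]
    congr 1
    ext y
    simp
  rw [h, Fin.prod_univ_add]
  simp only [Fin.prod_univ_add]
  have h11 : ∀ i i' : Fin n, (if Fin.castAdd k i < Fin.castAdd k i' then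
      (if a.perm (Fin.castAdd k i) < a.perm (Fin.castAdd k i') then (1 : ℤˣ) else -1) else 1) = 1 :=
    fun i i' => by
    split_ifs with h1 h2
    · rfl
    · refine absurd ?_ h2
      rw [Fin.lt_def, a.perm_castAdd, a.perm_castAdd]
      exact a.expo_strictAnti (Fin.rev_lt_rev.2 h1)
    · rfl
  have h22 : ∀ j j' : Fin k, (if Fin.natAdd n j < Fin.natAdd n j' then
      (if a.perm (Fin.natAdd n j) < a.perm (Fin.natAdd n j') then (1 : ℤˣ) else -1) else 1) = 1 :=
    fun j j' => by
    split_ifs with h1 h2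
    · rfl
    · refine absurd ?_ h2
      rw [Fin.lt_def, a.perm_natAdd, a.perm_natAdd]
      refine a.coexpo_lt_coexpo ?_
      have h3 := Fin.lt_def.1 h1
      simp only [Fin.val_natAdd] at h3
      omega
    · rfl
  have h21 : ∀ (j : Fin k) (i : Fin n), (if Fin.natAdd n j < Fin.castAdd k i then
      (if a.perm (Fin.natAdd n j) < a.perm (Fin.castAdd k i) then (1 : ℤˣ) else -1) else 1) = 1 :=
    fun j i => by
    rw [if_neg]
    simp only [Fin.lt_def, Fin.val_natAdd, Fin.val_castAdd]
    omega
  have h12 : ∀ (i : Fin n) (j : Fin k), (if Fin.castAdd k i < Fin.natAdd n j then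
      (if a.perm (Fin.castAdd k i) < a.perm (Fin.natAdd n j) then (1 : ℤˣ) else -1) else 1) =
      if (i.rev : ℕ) < a.diagram.colLen j then -1 else 1 := fun i j => by
    rw [if_pos]
    · have := a.expo_lt_coexpo_iff i.rev j
      simp only [Fin.lt_def, a.perm_castAdd, a.perm_natAdd, this, ite_not]
    · simp only [Fin.lt_def, Fin.val_natAdd, Fin.val_castAdd]
      omega
  simp only [h11, h12, h21, h22, Finset.prod_const_one, one_mul, mul_one]
  rw [Finset.prod_comm, ← Finset.prod_pow_eq_pow_sum]
  refine Finset.prod_congr rfl fun j _ => ?_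
  have hrev : (∏ i : Fin n, if (i.rev : ℕ) < a.diagram.colLen j then (-1 : ℤˣ) else 1) =
      ∏ i : Fin n, if (i : ℕ) < a.diagram.colLen j then (-1 : ℤˣ) else 1 :=
    Equiv.prod_comp Fin.revPerm (fun i : Fin n => if (i : ℕ) < a.diagram.colLen j then
      (-1 : ℤˣ) else 1)
  rw [hrev, ← Finset.prod_filter, Finset.prod_const, Fin.card_filter_val_lt,
    Nat.min_eq_right (a.colLen_lt j).le]

/-! ## Complementary minors -/

/-- Jacobi's complementary minor identity. For blocks A, B, C, D, multiplying M by its adjoint with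
the first block column replaced by (1, 0) gives a block lower triangular matrix with diagonal blocks
A and c · 1; then take determinants. -/
theorem det_mul_conj_det_toBlocks {ι κ : Type*} [Fintype ι] [Fintype κ] [DecidableEq ι]
    [DecidableEq κ] {M : Matrix (ι ⊕ κ) (ι ⊕ κ) ℂ} {c : ℂ} (hM : M * M.conjTranspose = c • 1) :
    M.det * (starRingEnd ℂ) M.toBlocks₂₂.det = c ^ Fintype.card κ * M.toBlocks₁₁.det := by
  obtain ⟨A, B, C, D, rfl⟩ : ∃ A B C D, M = Matrix.fromBlocks A B C D :=
    ⟨_, _, _, _, (Matrix.fromBlocks_toBlocks M).symm⟩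
  rw [Matrix.fromBlocks_conjTranspose, Matrix.fromBlocks_multiply, ← Matrix.fromBlocks_one,
    Matrix.fromBlocks_smul, Matrix.fromBlocks_inj] at hM
  obtain ⟨_, h12, _, h22⟩ := hM
  have h : Matrix.fromBlocks A B C D * Matrix.fromBlocks 1 C.conjTranspose 0 D.conjTranspose =
      Matrix.fromBlocks A 0 C (c • 1) := by
    rw [Matrix.fromBlocks_multiply, h12, h22]
    simp
  have h2 := congrArg Matrix.det h
  rw [Matrix.det_mul, Matrix.det_fromBlocks_zero₂₁, Matrix.det_fromBlocks_zero₁₂, Matrix.det_one,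
    one_mul, Matrix.det_conjTranspose, Matrix.det_smul, Matrix.det_one, mul_one] at h2
  rw [Matrix.toBlocks_fromBlocks₂₂, Matrix.toBlocks_fromBlocks₁₁, mul_comm (c ^ _), ← h2]
  rfl

theorem rootAt_ne_zero (m : ℝ) (c : ℕ) : rootAt n k m c ≠ 0 := Complex.exp_ne_zero _

theorem conj_rootAt (m : ℝ) (c : ℕ) :
    (starRingEnd ℂ) (rootAt n k m c) = (rootAt n k m c)⁻¹ := by
  unfold rootAt
  rw [← Complex.exp_conj, ← Complex.exp_neg]
  congr 1
  simp only [map_mul, map_neg, map_div₀, map_add, Complex.conj_ofReal, Complex.conj_I,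
    map_natCast, map_ofNat]
  ring

theorem rootAt_pow [NeZero n] (m : ℝ) (c : ℕ) :
    rootAt n k m c ^ (n + k) = Complex.exp (2 * Real.pi * Complex.I * m) := by
  have hkn : (k : ℂ) + n ≠ 0 := by
    rw [← Nat.cast_add]
    exact Nat.cast_ne_zero.2 (by have := NeZero.pos n; omega)
  unfold rootAt
  rw [← Complex.exp_nat_mul, ← Complex.exp_periodic.nat_mul c]
  congr 1
  push_cast
  rw [add_comm (n : ℂ)]
  field_simp
  ring

/-- The matrix of powers of the roots `rootAt n k m c`. -/
def rootMatrix (n k : ℕ) (m : ℝ) : Matrix (Fin (n + k)) (Fin (n + k)) ℂ :=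
  Matrix.of fun a b => rootAt n k m a ^ (b : ℕ)

theorem rootMatrix_mul_conjTranspose [NeZero n] (m : ℝ) :
    rootMatrix n k m * (rootMatrix n k m).conjTranspose = ((n + k : ℕ) : ℂ) • 1 := by
  ext a a'
  rw [Matrix.mul_apply, Matrix.smul_apply, Matrix.one_apply]
  have h : ∀ b : Fin (n + k), rootMatrix n k m a b * (rootMatrix n k m).conjTranspose b a' =
      (rootAt n k m a * (rootAt n k m a')⁻¹) ^ (b : ℕ) := fun b => by
    rw [Matrix.conjTranspose_apply, mul_pow, ← conj_rootAt, ← map_pow]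
    rfl
  rw [Finset.sum_congr rfl fun b _ => h b,
    Fin.sum_univ_eq_sum_range (fun b => (rootAt n k m a * (rootAt n k m a')⁻¹) ^ b)]
  split_ifs with haa
  · subst haa
    simp [mul_inv_cancel₀ (rootAt_ne_zero m (a : ℕ))]
  · have hne : rootAt n k m a * (rootAt n k m a')⁻¹ ≠ 1 := fun h1 => by
      rw [mul_inv_eq_one₀ (rootAt_ne_zero m _)] at h1
      exact haa (Fin.ext (rootAt_injOn a.2 a'.2 h1))
    rw [geom_sum_eq hne, mul_pow, inv_pow, rootAt_pow, rootAt_pow,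
      mul_inv_cancel₀ (Complex.exp_ne_zero _)]
    simp

/-- The point `x(σ)` at which Schur polynomials in `k` variables are evaluated. -/
def Weight.copoint (s : Weight n k) (i : Fin k) : ℂ := -rootAt n k s.mean (s.coexpo i)

/-- Jacobi's identity is applied to the matrix of powers with rows split by the exponents of `s` and
columns by those of `a`. The sign (-1)^|λ| of the column permutation is cancelled by the minus sign
in `Weight.copoint`, so that `W` depends on `s` alone. -/
theorem complementary_alternant [NeZero n] (s : Weight n k) :
    ∃ W : ℂ, ∀ a : Weight n k, W * alternant s.copoint (fun j =>
      a.diagram.colLen j + stair k j) = alternant s.point a.expo := by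
  set N : ℂ := ((n + k : ℕ) : ℂ) with hN
  have hN0 : N ≠ 0 := Nat.cast_ne_zero.2 (by have := NeZero.pos n; omega)
  set F := rootMatrix n k s.mean with hF
  refine ⟨(N ^ k)⁻¹ * (F.submatrix s.perm id).det *
    (∏ i : Fin k, (rootAt n k s.mean (s.coexpo i))⁻¹ ^ (n + k - 1)) *
      (-1) ^ (∑ j, stair k j), fun a => ?_⟩
  set M : Matrix (Fin n ⊕ Fin k) (Fin n ⊕ Fin k) ℂ :=
    F.submatrix (finSumFinEquiv.trans s.perm) (finSumFinEquiv.trans a.perm) with hM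
  have hMM : M * M.conjTranspose = N • 1 := by
    rw [hM, Matrix.conjTranspose_submatrix, Matrix.submatrix_mul_equiv,
      rootMatrix_mul_conjTranspose, Matrix.submatrix_smul, Pi.smul_apply, Pi.smul_apply,
      Matrix.submatrix_one_equiv]
  have key := det_mul_conj_det_toBlocks hMM
  have hdet : M.det = ((-1) ^ ∑ j : Fin k, a.diagram.colLen j) * (F.submatrix s.perm id).det := by
    have h1 : M = ((F.submatrix s.perm id).submatrix id a.perm).submatrix
        finSumFinEquiv finSumFinEquiv := by
      ext x y
      rfl
    rw [h1, Matrix.det_submatrix_equiv_self, Matrix.det_permute', a.sign_perm]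
    push_cast
    rfl
  have h11 : M.toBlocks₁₁.det = alternant s.point a.expo := by
    unfold alternant
    rw [← Matrix.det_transpose, ← Matrix.det_submatrix_equiv_self Fin.revPerm]
    congr 1
    ext i j
    simp only [Matrix.submatrix_apply, Matrix.transpose_apply, Matrix.toBlocks₁₁, Matrix.of_apply,
      hM, hF, rootMatrix, Equiv.trans_apply, finSumFinEquiv_apply_left, Weight.perm_castAdd,
      Fin.revPerm_apply, Fin.rev_rev]
    rfl
  have h22 : (starRingEnd ℂ) M.toBlocks₂₂.det =
      (∏ i : Fin k, (rootAt n k s.mean (s.coexpo i))⁻¹ ^ (n + k - 1)) *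
        alternant (fun i => rootAt n k s.mean (s.coexpo i))
          (fun j => a.diagram.colLen j + stair k j) := by
    unfold alternant
    rw [← Matrix.det_transpose, RingHom.map_det, ← Matrix.det_mul_row]
    congr 1
    ext i j
    simp only [Matrix.transpose_apply, Matrix.toBlocks₂₂, Matrix.of_apply, RingHom.mapMatrix_apply,
      Matrix.map_apply, hM, hF, rootMatrix, Matrix.submatrix_apply,
      Equiv.trans_apply, finSumFinEquiv_apply_right, Weight.perm_natAdd, map_pow, conj_rootAt]
    have h1 := a.colLen_lt i
    -- Conjugation makes the powers negative; multiplying each root by its power n + k - 1 brings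
    -- them to the exponents of the transposed diagram.
    have h2 : n + k - 1 = a.coexpo i + (a.diagram.colLen i + stair k i) := by
      simp only [Weight.coexpo, stair, Fin.val_rev]
      omega
    rw [h2, pow_add, mul_assoc, ← mul_pow, inv_mul_cancel₀ (rootAt_ne_zero _ _), one_pow, mul_one]
  have hneg : alternant s.copoint (fun j => a.diagram.colLen j + stair k j) =
      (-1) ^ (∑ j : Fin k, (a.diagram.colLen j + stair k j)) *
        alternant (fun i => rootAt n k s.mean (s.coexpo i))
          (fun j => a.diagram.colLen j + stair k j) := by
    rw [← alternant_smul]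
    congr 1
    funext i
    simp [Weight.copoint]
  rw [hdet, h22, h11, Fintype.card_fin] at key
  rw [hneg, Finset.sum_add_distrib, pow_add]
  have hs : ((-1 : ℂ) ^ ∑ j, stair k j) * (-1) ^ ∑ j, stair k j = 1 := by
    rw [← mul_pow]; simp
  have hNk : N ^ k * (N ^ k)⁻¹ = 1 := mul_inv_cancel₀ (pow_ne_zero k hN0)
  refine mul_left_cancel₀ (pow_ne_zero k hN0) ?_
  rw [← key]
  generalize (F.submatrix s.perm id).det = p1
  generalize (∏ i : Fin k, (rootAt n k s.mean (s.coexpo i))⁻¹ ^ (n + k - 1)) = p2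
  generalize alternant (fun i => rootAt n k s.mean (s.coexpo i)) _ = p3
  generalize ((-1 : ℂ) ^ ∑ j, stair k j) = e1 at hs ⊢
  generalize ((-1 : ℂ) ^ ∑ j : Fin k, a.diagram.colLen j) = e2
  linear_combination (p1 * p2 * e2 * p3 * e1 * e1) * hNk + (p1 * p2 * e2 * p3) * hs

/-- The common factor `W` cancels between the alternants of λ^t and of the empty partition, leaving
the bialternant formula at `s.copoint`. -/
theorem eval_schur [NeZero n] (a s : Weight n k) :
    MvPolynomial.aeval s.copoint (a.schur : MvPolynomial (Fin k) ℤ) *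
      alternant s.point (vacuum n k).expo = alternant s.point a.expo := by
  obtain ⟨W, hW⟩ := complementary_alternant s

  have h1 := map_schurPoly_mul_alternant
    (MvPolynomial.aeval s.copoint : MvPolynomial (Fin k) ℤ →ₐ[ℤ] ℂ).toRingHom a.colLen_transpose_le
  simp only [AlgHom.toRingHom_eq_coe, RingHom.coe_coe, MvPolynomial.aeval_X,
    YoungDiagram.rowLen_transpose] at h1
  have h2 := hW (vacuum n k)
  simp only [colLen_vacuum, zero_add] at h2
  rw [← h2, ← hW a]
  change MvPolynomial.aeval s.copoint (schurPoly k a.diagram.transpose) * _ = _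
  rw [mul_left_comm]
  exact congrArg (W * ·) h1

/-! ## The points satisfy the relations of the fusion ideal -/

theorem prod_one_add_rootAt [NeZero n] (m : ℝ) :
    ∏ c : Fin (n + k), (1 + Polynomial.C (rootAt n k m c) * Polynomial.X) =
      1 - Polynomial.C ((-1) ^ (n + k) * Complex.exp (2 * Real.pi * Complex.I * m)) *
        Polynomial.X ^ (n + k) := by
  have hN : 0 < n + k := by have := NeZero.pos n; omega
  -- Both sides have degree at most n + k and agree at n + k + 1 points: 0 and the negative inverses
  -- of the roots.
  refine Polynomial.eq_of_natDegree_lt_card_of_eval_eq _ _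
    (f := fun o : Option (Fin (n + k)) => o.elim (0 : ℂ) fun c => -(rootAt n k m c)⁻¹) ?_ ?_ ?_
  · rintro (_ | c) (_ | c') h
    · rfl
    · exact absurd h.symm (neg_ne_zero.2 (inv_ne_zero (rootAt_ne_zero m _)))
    · exact absurd h (neg_ne_zero.2 (inv_ne_zero (rootAt_ne_zero m _)))
    · rw [Fin.ext (rootAt_injOn c.2 c'.2 (inv_injective (neg_injective h)))]
  · rintro (_ | c)
    · simp [Polynomial.eval_prod, -map_mul, zero_pow hN.ne']
    · rw [Polynomial.eval_prod, Finset.prod_eq_zero (Finset.mem_univ c)]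
      · have h1 : ((-1 : ℂ) ^ (n + k)) * (-1) ^ (n + k) = 1 := by rw [← mul_pow]; simp
        have h2 := mul_inv_cancel₀ (Complex.exp_ne_zero (2 * Real.pi * Complex.I * m))
        simp only [Option.elim_some, Polynomial.eval_sub, Polynomial.eval_one,
          Polynomial.eval_mul, Polynomial.eval_C, Polynomial.eval_pow, Polynomial.eval_X]
        rw [neg_pow (rootAt n k m c)⁻¹, inv_pow, rootAt_pow, mul_mul_mul_comm, h1, h2, mul_one,
          sub_self]
      · simp [mul_inv_cancel₀ (rootAt_ne_zero m (c : ℕ))]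
  · rw [Fintype.card_option, Fintype.card_fin, Nat.lt_succ_iff, max_le_iff]
    constructor
    · refine (Polynomial.natDegree_prod_le _ _).trans
        ((Finset.sum_le_card_nsmul _ _ 1 fun c _ => ?_).trans (by simp))
      have := natDegree_one_sub_C_mul_X_le (-rootAt n k m c)
      simpa [sub_eq_add_neg] using this
    · refine (Polynomial.natDegree_sub_le _ _).trans ?_
      rw [Polynomial.natDegree_one, Nat.max_eq_right (Nat.zero_le _)]
      exact Polynomial.natDegree_C_mul_X_pow_le _ _

theorem prod_one_add_rootAt_eq_mul [NeZero n] (s : Weight n k) :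
    ∏ c : Fin (n + k), (1 + Polynomial.C (rootAt n k s.mean c) * Polynomial.X) =
      (∏ i, (1 + Polynomial.C (s.point i) * Polynomial.X)) *
        ∏ j, (1 - Polynomial.C (s.copoint j) * Polynomial.X) := by
  rw [← Equiv.prod_comp s.perm, Fin.prod_univ_add]
  simp only [Weight.perm_castAdd, Weight.perm_natAdd, Weight.copoint, Polynomial.C_neg, neg_mul,
    sub_neg_eq_add]
  refine congrArg (· * ∏ j : Fin k,
    (1 + Polynomial.C (rootAt n k s.mean (s.coexpo j)) * Polynomial.X)) ?_
  exact Equiv.prod_comp Fin.revPerm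
    (fun i : Fin n => (1 + Polynomial.C (s.point i) * Polynomial.X))

/-- Evaluation of symmetric polynomials at the point attached to a weight. -/
def evalAt (s : Weight n k) : SymPoly k →+* ℂ :=
  (MvPolynomial.aeval s.copoint : MvPolynomial (Fin k) ℤ →ₐ[ℤ] ℂ).toRingHom.comp
    (MvPolynomial.symmetricSubalgebra (Fin k) ℤ).val.toRingHom

theorem evalAt_apply (s : Weight n k) (f : SymPoly k) :
    evalAt s f = MvPolynomial.aeval s.copoint (f : MvPolynomial (Fin k) ℤ) := rfl

/-- The factors 1 - x_j t, which invert H(t), are those of the complementary roots in the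
factorization of 1 - c t^(n+k); the factors 1 + y_i t remain. -/
theorem mk_evalAt_h [NeZero n] (s : Weight n k) :
    PowerSeries.mk (fun r => evalAt s (h k r)) *
      (1 - PowerSeries.C ((-1) ^ (n + k) * Complex.exp (2 * Real.pi * Complex.I * s.mean)) *
        PowerSeries.X ^ (n + k)) =
      ((∏ i, (1 + Polynomial.C (s.point i) * Polynomial.X) : Polynomial ℂ) : PowerSeries ℂ) := by
  have h1 := mk_hsymm_mul_prod
    (MvPolynomial.aeval s.copoint : MvPolynomial (Fin k) ℤ →ₐ[ℤ] ℂ).toRingHom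
  have h2 := congrArg (Polynomial.coeToPowerSeries.ringHom (R := ℂ))
    ((prod_one_add_rootAt (k := k) s.mean).symm.trans (prod_one_add_rootAt_eq_mul s))
  rw [map_mul (Polynomial.coeToPowerSeries.ringHom (R := ℂ)) (∏ i, _) (∏ j, _),
    map_prod (Polynomial.coeToPowerSeries.ringHom (R := ℂ)) _
      (Finset.univ : Finset (Fin k))] at h2
  simp only [map_sub, map_mul, map_pow, map_one, Polynomial.coeToPowerSeries.ringHom_apply,
    Polynomial.coe_C, Polynomial.coe_X] at h2
  simp only [AlgHom.toRingHom_eq_coe, RingHom.coe_coe, MvPolynomial.aeval_X] at h1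
  simp only [map_mul, map_pow]
  rw [h2, mul_left_comm]
  change _ * (PowerSeries.mk (fun r => MvPolynomial.aeval s.copoint
    (MvPolynomial.hsymm (Fin k) ℤ r)) * _) = _
  rw [h1, mul_one]

theorem coeff_prod_point [NeZero n] (s : Weight n k) {r : ℕ} (hr : n ≤ r) :
    (∏ i, (1 + Polynomial.C (s.point i) * Polynomial.X) : Polynomial ℂ).coeff r =
      if r = n then 1 else 0 := by
  have hdeg : ∀ i, (1 + Polynomial.C (s.point i) * Polynomial.X).natDegree ≤ 1 := fun i => by
    have := natDegree_one_sub_C_mul_X_le (-s.point i)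
    simpa [sub_eq_add_neg] using this
  split_ifs with h
  · have h1 := Polynomial.coeff_prod_of_natDegree_le (s := Finset.univ)
      (fun i => 1 + Polynomial.C (s.point i) * Polynomial.X) 1 (fun i _ => hdeg i)
    rw [mul_one, Finset.card_univ, Fintype.card_fin] at h1
    rw [h, h1, ← prod_point s]
    refine Finset.prod_congr rfl fun i _ => ?_
    simp [Polynomial.coeff_one]
  · refine Polynomial.coeff_eq_zero_of_natDegree_lt (lt_of_le_of_lt
      ((Polynomial.natDegree_prod_le _ _).trans
        (Finset.sum_le_card_nsmul _ _ 1 fun i _ => hdeg i)) ?_)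
    simp only [Finset.card_univ, Fintype.card_fin, smul_eq_mul, mul_one]
    omega

theorem evalAt_h_of_lt [NeZero n] (s : Weight n k) {r : ℕ} (hr : n ≤ r) (hr' : r < n + k) :
    evalAt s (h k r) = if r = n then 1 else 0 := by
  have h1 := congrArg (PowerSeries.coeff r) (mk_evalAt_h s)
  rw [Polynomial.coeff_coe, coeff_prod_point s hr, mul_sub, mul_one, map_sub, mul_left_comm,
    PowerSeries.coeff_C_mul, PowerSeries.coeff_mul_X_pow', if_neg (by omega), mul_zero, sub_zero,
    PowerSeries.coeff_mk] at h1
  exact h1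

/-- As k > 0, the degree n + k exceeds that of ∏ (1 + y_i t), so h_{n+k} = c h_0. -/
theorem evalAt_h_add [NeZero n] [NeZero k] (s : Weight n k) :
    evalAt s (h k (n + k)) = (-1) ^ (n + k) * Complex.exp (2 * Real.pi * Complex.I * s.mean) := by
  have hk := NeZero.pos k
  have h1 := congrArg (PowerSeries.coeff (n + k)) (mk_evalAt_h s)
  rw [Polynomial.coeff_coe, coeff_prod_point s (by omega), if_neg (by omega), mul_sub, mul_one,
    map_sub, mul_left_comm, PowerSeries.coeff_C_mul, PowerSeries.coeff_mul_X_pow', if_pos le_rfl,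
    Nat.sub_self, PowerSeries.coeff_mk, PowerSeries.coeff_mk] at h1
  have h0 : evalAt s (h k 0) = 1 := by
    rw [evalAt_apply]
    change MvPolynomial.aeval s.copoint (MvPolynomial.hsymm (Fin k) ℤ 0) = 1
    simp
  rw [h0, mul_one] at h1
  exact sub_eq_zero.1 h1

/-- The left side is the product of the complementary roots. Since ∏ y_i = 1, it equals the product
of all n + k roots, the leading coefficient -c. -/
theorem evalAt_e [NeZero n] (s : Weight n k) :
    (-1) ^ k * evalAt s (e k k) =
      -((-1) ^ (n + k) * Complex.exp (2 * Real.pi * Complex.I * s.mean)) := by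
  have hN : n + k ≠ 0 := by have := NeZero.pos n; omega
  have h1 : evalAt s (e k k) = ∏ j, s.copoint j := by
    rw [evalAt_apply]
    change MvPolynomial.aeval s.copoint (MvPolynomial.esymm (Fin k) ℤ k) = _
    have h2 := Finset.powersetCard_self (Finset.univ : Finset (Fin k))
    rw [Finset.card_univ, Fintype.card_fin] at h2
    rw [MvPolynomial.esymm, h2, Finset.sum_singleton, map_prod]
    simp
  have h3 := congrArg (fun p : Polynomial ℂ => p.coeff (n + k))     (prod_one_add_rootAt (n := n) (k := k) s.mean)
  have h4 := Polynomial.coeff_prod_of_natDegree_le (s := Finset.univ)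
    (fun c : Fin (n + k) => 1 + Polynomial.C (rootAt n k s.mean c) * Polynomial.X) 1
    (fun c _ => by
      have := natDegree_one_sub_C_mul_X_le (-rootAt n k s.mean c)
      simpa [sub_eq_add_neg] using this)
  rw [mul_one, Finset.card_univ, Fintype.card_fin] at h4
  change Polynomial.coeff _ _ = Polynomial.coeff _ _ at h3
  rw [h4, Polynomial.coeff_sub, Polynomial.coeff_C_mul_X_pow, if_pos rfl, Polynomial.coeff_one,
    if_neg hN, zero_sub] at h3
  rw [← h3, h1, ← Equiv.prod_comp s.perm, Fin.prod_univ_add]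
  simp only [Weight.perm_castAdd, Weight.perm_natAdd, Polynomial.coeff_add, Polynomial.coeff_one,
    one_ne_zero, if_false, zero_add, Polynomial.coeff_C_mul, Polynomial.coeff_X_one, mul_one]
  have h5 : ∏ i : Fin n, rootAt n k s.mean (s.expo i.rev) = 1 := by
    rw [← prod_point s, ← Equiv.prod_comp Fin.revPerm s.point]
    rfl
  rw [h5, one_mul]
  simp only [Weight.copoint]
  rw [Finset.prod_neg, Finset.card_univ, Fintype.card_fin, ← mul_assoc, ← mul_pow]
  simp

theorem evalAt_eq_zero [NeZero n] [NeZero k] (s : Weight n k) {f : SymPoly k}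
    (hf : f ∈ fusionIdeal n k) : evalAt s f = 0 := by
  have hk := NeZero.pos k
  have hle : fusionIdeal n k ≤ RingHom.ker (evalAt s) := by
    refine Ideal.span_le.2 ?_
    rintro p ((hp | ⟨i, hi, hik, rfl⟩) | hp)
    · rw [Set.mem_singleton_iff] at hp
      rw [SetLike.mem_coe, RingHom.mem_ker, hp, map_sub, map_one,
        evalAt_h_of_lt s le_rfl (by omega), if_pos rfl, sub_self]
    · rw [SetLike.mem_coe, RingHom.mem_ker, evalAt_h_of_lt s (by omega) (by omega),
        if_neg (by omega)]
    · rw [Set.mem_singleton_iff] at hp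
      rw [SetLike.mem_coe, RingHom.mem_ker, hp, map_add, map_mul, map_pow, map_neg, map_one,
        evalAt_h_add, evalAt_e, add_neg_cancel]
  exact hle hf

/-! ## The Verlinde formula and the fusion ring -/

theorem modularS_vacuum_ne_zero [NeZero n] (s : Weight n k) : modularS (vacuum n k) s ≠ 0 := by
  rw [modularS_eq]
  exact mul_ne_zero prefactor_ne_zero (alternant_point_vacuum_ne_zero s)

theorem evalAt_schur_mul [NeZero n] (a s : Weight n k) :
    evalAt s a.schur * modularS (vacuum n k) s = modularS a s := by
  rw [modularS_eq, modularS_eq, ← eval_schur a s, evalAt_apply]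
  ring

theorem sum_mul_sum_modularS [NeZero n] (x : Weight n k → ℂ) (d : Weight n k) :
    ∑ s, (∑ a, x a * modularS a s) * modularS d.conj s = x d := by
  have h1 : ∀ s, (∑ a, x a * modularS a s) * modularS d.conj s =
      ∑ a, x a * (modularS a s * modularS d.conj s) := fun s => by
    rw [Finset.sum_mul]
    exact Finset.sum_congr rfl fun a _ => mul_assoc _ _ _
  rw [Finset.sum_congr rfl fun s _ => h1 s, Finset.sum_comm]
  simp only [← Finset.mul_sum, sum_modularS_mul]
  simp

theorem evalAt_sum_zsmul_schur [NeZero n] (x : Weight n k → ℤ) (s : Weight n k) :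
    evalAt s (∑ a, x a • a.schur) * modularS (vacuum n k) s =
      ∑ a, (x a : ℂ) * modularS a s := by
  rw [map_sum, Finset.sum_mul]
  refine Finset.sum_congr rfl fun a _ => ?_
  rw [map_zsmul, zsmul_eq_mul, mul_assoc, evalAt_schur_mul]

/-- At the point of σ the congruence reads S_{aσ} S_{bσ} / S_{0σ} = ∑ c_d S_{dσ}; orthogonality
against the conjugate of `d` extracts `c d`. -/
theorem verlindeCoeff_eq_intCast [NeZero n] [NeZero k] {a b : Weight n k} {c : Weight n k → ℤ}
    (hc : a.schur * b.schur - ∑ d, c d • d.schur ∈ fusionIdeal n k) (d : Weight n k) :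
    verlindeCoeff a b d = c d := by
  unfold verlindeCoeff
  rw [← sum_mul_sum_modularS (fun d => (c d : ℂ)) d]
  refine Finset.sum_congr rfl fun s _ => ?_
  have h0 := modularS_vacuum_ne_zero s
  have h1 := evalAt_eq_zero s hc
  rw [map_sub, map_mul, sub_eq_zero] at h1
  rw [← evalAt_sum_zsmul_schur, ← h1, ← evalAt_schur_mul a s, ← evalAt_schur_mul b s]
  field_simp

theorem fusionCoeff_eq [NeZero n] [NeZero k] {a b : Weight n k} {c : Weight n k → ℤ}
    (hc : a.schur * b.schur - ∑ d, c d • d.schur ∈ fusionIdeal n k) (d : Weight n k) :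
    fusionCoeff a b d = c d := by
  rw [fusionCoeff, verlindeCoeff_eq_intCast hc, Complex.intCast_re, round_intCast]

theorem schur_mul_schur_sub_mem [NeZero n] [NeZero k] (a b : Weight n k) :
    a.schur * b.schur - ∑ d, fusionCoeff a b d • d.schur ∈ fusionIdeal n k := by
  obtain ⟨c, hc⟩ := exists_sub_mem_fusionIdeal (n := n) (a.schur * b.schur)
  simpa only [fusionCoeff_eq hc] using hc

theorem schur_vacuum [NeZero n] : (vacuum n k).schur = 1 := by

  have h1 := schurPoly_mul_alternant (vacuum n k).colLen_transpose_le
  simp only [YoungDiagram.rowLen_transpose, colLen_vacuum, zero_add] at h1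
  refine Subtype.ext (mul_right_cancel₀ (alternant_stair_ne_zero MvPolynomial.X_injective) ?_)
  rw [OneMemClass.coe_one, one_mul]
  exact h1

/-- The coordinates of an element of the fusion ring. -/
def FusionRing.coord (x : FusionRing n k) (a : Weight n k) : ℤ := x a

theorem FusionRing.coord_add (x y : FusionRing n k) (a : Weight n k) :
    (x + y).coord a = x.coord a + y.coord a := rfl

theorem FusionRing.coord_mul [NeZero n] (x y : FusionRing n k) (c : Weight n k) :
    (x * y).coord c = ∑ a, ∑ b, x.coord a * y.coord b * fusionCoeff a b c := rfl

theorem FusionRing.coord_basis [DecidableEq (Weight n k)] (a b : Weight n k) :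
    (FusionRing.basis a).coord b = if b = a then 1 else 0 := by
  -- The two sides differ only in the instance of decidable equality.
  have h : (FusionRing.basis a).coord b = Pi.single (M := fun _ => ℤ) a 1 b := by
    unfold FusionRing.coord FusionRing.basis
    congr!
  rw [h, Pi.single_apply]

/-- The linear map from the fusion ring to the quotient of the ring of symmetric polynomials. -/
def toQuotient (x : FusionRing n k) : SymPoly k ⧸ fusionIdeal n k :=
  Ideal.Quotient.mk _ (∑ a, x.coord a • a.schur)

theorem toQuotient_basis (a : Weight n k) :
    toQuotient (FusionRing.basis a) = Ideal.Quotient.mk (fusionIdeal n k) a.schur := by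
  classical
  unfold toQuotient
  simp [FusionRing.coord_basis]

theorem toQuotient_add (x y : FusionRing n k) :
    toQuotient (x + y) = toQuotient x + toQuotient y := by
  unfold toQuotient
  rw [← map_add, ← Finset.sum_add_distrib]
  simp only [FusionRing.coord_add, add_smul]

theorem toQuotient_mul [NeZero n] [NeZero k] (x y : FusionRing n k) :
    toQuotient (x * y) = toQuotient x * toQuotient y := by
  unfold toQuotient
  rw [← map_mul, Finset.sum_mul_sum, eq_comm, Ideal.Quotient.eq]
  have h1 : ∑ d, (x * y).coord d • d.schur =
      ∑ a, ∑ b, (x.coord a * y.coord b) • ∑ d, fusionCoeff a b d • (d : Weight n k).schur := by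
    simp only [FusionRing.coord_mul, Finset.sum_smul, Finset.smul_sum, smul_smul]
    rw [Finset.sum_comm]
    exact Finset.sum_congr rfl fun a _ => Finset.sum_comm
  rw [h1, ← Finset.sum_sub_distrib]
  refine Ideal.sum_mem _ fun a _ => ?_
  rw [← Finset.sum_sub_distrib]
  refine Ideal.sum_mem _ fun b _ => ?_
  rw [smul_mul_smul_comm, zsmul_eq_mul, zsmul_eq_mul, ← mul_sub]
  exact Ideal.mul_mem_left _ _ (schur_mul_schur_sub_mem a b)

/-- For injectivity, congruent combinations take equal values at every point, and inverting the
S-matrix recovers their coordinates. Surjectivity is the spanning statement. -/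
theorem toQuotient_bijective [NeZero n] [NeZero k] :
    Function.Bijective (toQuotient : FusionRing n k → SymPoly k ⧸ fusionIdeal n k) := by
  constructor
  · intro x y hxy
    have hmem := Ideal.Quotient.eq.1 hxy
    funext d
    have hs : ∀ s : Weight n k,
        ∑ a, (x.coord a : ℂ) * modularS a s = ∑ a, (y.coord a : ℂ) * modularS a s := fun s => by
      have h1 := evalAt_eq_zero s hmem
      rw [map_sub, sub_eq_zero] at h1
      rw [← evalAt_sum_zsmul_schur, ← evalAt_sum_zsmul_schur, h1]
    have h2 := sum_mul_sum_modularS (fun a => (x.coord a : ℂ)) d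
    simp only [hs] at h2
    rw [sum_mul_sum_modularS (fun a => (y.coord a : ℂ)) d] at h2
    exact (Int.cast_injective h2).symm
  · intro q
    obtain ⟨f, rfl⟩ := Ideal.Quotient.mk_surjective q
    obtain ⟨c, hc⟩ := exists_sub_mem_fusionIdeal (n := n) f
    exact ⟨c, (Ideal.Quotient.eq.2 hc).symm⟩

/-- The isomorphism from the fusion ring to the quotient of the ring of symmetric polynomials. -/
def fusionEquiv [NeZero n] [NeZero k] : FusionRing n k ≃+* SymPoly k ⧸ fusionIdeal n k :=
  { Equiv.ofBijective _ toQuotient_bijective with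
    map_mul' := toQuotient_mul
    map_add' := toQuotient_add }

end AffineFusion
end

/-- For `n, k ≥ 1` the Verlinde sums are integers, and `λ̂ ↦ s_{λ^t}` defines an isomorphism of rings
from the level `k` fusion ring onto the quotient of the ring of symmetric polynomials in `k`
variables. -/
theorem theorem5p10 (n k : ℕ) [NeZero n] [NeZero k] :
    (∀ a b c : AffineFusion.Weight n k,
      AffineFusion.verlindeCoeff a b c = (AffineFusion.fusionCoeff a b c : ℂ)) ∧
    ∃ Φ : AffineFusion.FusionRing n k ≃+*
        (AffineFusion.SymPoly k ⧸ AffineFusion.fusionIdeal n k),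
      Φ 1 = 1 ∧
      ∀ a : AffineFusion.Weight n k, ∃ s : AffineFusion.SymPoly k,
        (s : MvPolynomial (Fin k) ℤ) = AffineFusion.schurPoly k a.diagram.transpose ∧
        Φ (AffineFusion.FusionRing.basis a) =
          Ideal.Quotient.mk (AffineFusion.fusionIdeal n k) s := by
  refine ⟨fun a b c =>
    AffineFusion.verlindeCoeff_eq_intCast (AffineFusion.schur_mul_schur_sub_mem a b) c,
    AffineFusion.fusionEquiv, ?_, fun a => ⟨a.schur, rfl, AffineFusion.toQuotient_basis a⟩⟩
  refine (AffineFusion.toQuotient_basis (AffineFusion.vacuum n k)).trans ?_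
  rw [AffineFusion.schur_vacuum, map_one]
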